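/- Let $n\ge 2$, let $\Omega\subset\mathbb R^n$ be a bounded open set, $I=(T_0,T_1)$ a bounded open interval, and $\delta_1,\dots,\delta_n\ge 0$. Put $\Delta^+=\{\delta_i:\delta_i>0\}$, with $\inf\emptyset=+\infty$. For $s\in\mathbb R$ set $g_i(s)=\tfrac12(|s|-\delta_i)_+^2$ and, for $0<\varepsilon<\min\{1,\inf\Delta^+\}$, let $\tilde g_{i,\varepsilon}=g_i$ if $\delta_i=0$, while if $\delta_i>0$ let $$\tilde g_{i,\varepsilon}(s)=\begin{cases}0,&|s|\le\delta_i-\varepsilon,\\ \frac1{12\varepsilon}(|s|-\delta_i+\varepsilon)^3,&\delta_i-\varepsilon\le|s|\le\delta_i+\varepsilon,\\ \frac{\varepsilon^2}{6}+\frac12(|s|-\delta_i)^2,&|s|\ge\delta_i+\varepsilon.\end{cases}$$ Define $$F_0(\xi)=\sum_{i=1}^n g_i(\xi_i),\qquad F_\varepsilon(\xi)=\sum_{i=1}^n\tilde g_{i,\varepsilon}(\xi_i)+\frac\varepsilon2(1+|\xi|^2),\qquad K_{i,\varepsilon}(s)=\int_0^s\sqrt{\tilde g_{i,\varepsilon}''(\tau)}\,d\tau,$$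 and $H_\lambda(s)=(|s|-\lambda)_+\frac{s}{|s|}$ for $s\neq0$, $H_\lambda(0)=0$. Let $u\in L^2_{loc}(I;W^{1,2}_{loc}(\Omega))$ be a local weak solution of $\partial_t u=\mathrm{div}[D_\xi F_0(Du)]$ in $\Omega\times I$, that is, $\iint_{\Omega\times I}(u\,\partial_t\varphi-\langle D_\xi F_0(Du),D\varphi\rangle)\,dx\,dt=0$ for all $\varphi\in C_0^\infty(\Omega\times I)$, where $D$ denotes the spatial gradient. Let $\Omega'$ be an open set whose closure is a compact subset of $\Omega$, and let $J=(\tau_0,\tau_1)$ with $T_0<\tau_0<\tau_1<T_1$. For $0<\varepsilon<\min\{1,\inf\Delta^+\}$ let $u_\varepsilon\in L^2(J;W^{1,2}(\Omega'))\cap C^0([\tau_0,\tau_1];L^2(\Omega'))$ be the weak solution of $$\partial_t v=\mathrm{div}[D_\xi F_\varepsilon(Dv)]\ \text{in }\Omega'\times J,\qquad v=u\ \text{on }\partial\Omega'\times J,\qquad v(\cdot,\tau_0)=u(\cdot,\tau_0)\ \text{in }\Omega',$$ where the equation is tested with all $\varphi\in C_0^\infty(\Omega'\times J)$, the lateral condition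 means $u_\varepsilon-u\in L^2(J;W^{1,2}_0(\Omega'))$, and the initial condition is taken in the $L^2(\Omega')$ sense. Then there is a constant $c>0$ depending only on $n$ such that the following holds. Both $u$ and $u_\varepsilon$ belong to $C^0([\tau_0,\tau_1];L^2(\Omega'))$, and, with $u(\cdot,\tau_1)$, $u_\varepsilon(\cdot,\tau_1)$ the values of the continuous representatives, $$\int_{\Omega'}|u_\varepsilon-u|^2(x,\tau_1)\,dx+\sum_{i=1}^n\iint_{\Omega'\times J}|K_{i,\varepsilon}(\partial_{x_i}u_\varepsilon)-K_{i,\varepsilon}(\partial_{x_i}u)|^2\,dx\,dt+\varepsilon\iint_{\Omega'\times J}|Du_\varepsilon-Du|^2\,dx\,dt\le c\,\varepsilon\Big(|\Omega'\times J|+\iint_{\Omega'\times J}|Du|^2\,dx\,dt\Big),$$ and $$\iint_{\Omega'\times J}|Du_\varepsilon|^2\,dx\,dt\le 2(c+1)\Big(|\Omega'\times J|+\iint_{\Omega'\times J}|Du|^2\,dx\,dt\Big).$$ Furthermore, for each $j\in\{1,\dots,n\}$, $K_{j,\varepsilon}(\partial_{x_j}u_\varepsilon)\to H_{\delta_j}(\partial_{x_j}u)$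 strongly in $L^2(\Omega'\times J)$ as $\varepsilon\to0^+$. -/

import Mathlib

open MeasureTheory Filter Topology
open scoped ContDiff

/-- `φ` is a smooth real function with compact support contained in the open set `U`,
that is, `φ ∈ C₀^∞(U)`. -/
def IsTestFunction {X : Type*} [NormedAddCommGroup X] [NormedSpace ℝ X]
    (U : Set X) (φ : X → ℝ) : Prop :=
  ContDiff ℝ ∞ φ ∧ HasCompactSupport φ ∧ tsupport φ ⊆ U

section Structure

/-- `g_i(s) = (|s| - δ_i)_+² / 2`, where `d` stands for `δ_i`. -/
noncomputable def gDeg (d s : ℝ) : ℝ := (1 / 2) * (max (|s| - d) 0) ^ 2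

/-- The `C²` regularization `g_{i,ε}` of `g_i`, for `0 < ε < δ_i` (`d` stands for `δ_i`). -/
noncomputable def gEps (d ε s : ℝ) : ℝ :=
  if |s| ≤ d - ε then 0
  else if |s| ≤ d + ε then (1 / (12 * ε)) * (|s| - d + ε) ^ 3
  else ε ^ 2 / 6 + (1 / 2) * (|s| - d) ^ 2

/-- `g̃_{i,ε}`: equal to `g_i` if `δ_i = 0` and to `g_{i,ε}` if `δ_i > 0`. -/
noncomputable def gTilde (d ε : ℝ) : ℝ → ℝ :=
  if d = 0 then gDeg d else gEps d ε

/-- `K_{i,ε}(s) = ∫_0^s √(g̃_{i,ε}''(τ)) dτ`. -/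
noncomputable def KEps (d ε s : ℝ) : ℝ :=
  ∫ τ in (0 : ℝ)..s, √(deriv (deriv (gTilde d ε)) τ)

/-- `H_λ(s) = (|s| - λ)_+ s / |s|` for `s ≠ 0` and `H_λ(0) = 0` (the case `p = 2`). -/
noncomputable def HFun (lam s : ℝ) : ℝ :=
  if s = 0 then 0 else max (|s| - lam) 0 * (s / |s|)

/-- `F_0(ξ) = ∑_i (|ξ_i| - δ_i)_+² / 2`. -/
noncomputable def F0 {n : ℕ} (δ : Fin n → ℝ) (ξ : EuclideanSpace ℝ (Fin n)) : ℝ :=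
  ∑ i, gDeg (δ i) (ξ i)

/-- `F_ε(ξ) = ∑_i g̃_{i,ε}(ξ_i) + (ε / 2) (1 + |ξ|²)`. -/
noncomputable def FEps {n : ℕ} (δ : Fin n → ℝ) (ε : ℝ) (ξ : EuclideanSpace ℝ (Fin n)) : ℝ :=
  ∑ i, gTilde (δ i) ε (ξ i) + (ε / 2) * (1 + ‖ξ‖ ^ 2)

/-- `ε ∈ (0, min {1, inf Δ⁺})`, where `Δ⁺ = {δ_i : δ_i > 0}` and `inf ∅ = +∞`. -/
def AdmissibleEps {n : ℕ} (δ : Fin n → ℝ) (ε : ℝ) : Prop :=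
  0 < ε ∧ ε < 1 ∧ ∀ i, 0 < δ i → ε < δ i

end Structure

section Spaces

variable {n : ℕ}

/-- `G` is the weak (distributional) gradient of `f` in the open set `U ⊆ ℝⁿ`. -/
def HasWeakGradient (U : Set (EuclideanSpace ℝ (Fin n)))
    (f : EuclideanSpace ℝ (Fin n) → ℝ)
    (G : EuclideanSpace ℝ (Fin n) → EuclideanSpace ℝ (Fin n)) : Prop :=
  LocallyIntegrableOn f U ∧ LocallyIntegrableOn G U ∧
    ∀ φ : EuclideanSpace ℝ (Fin n) → ℝ, IsTestFunction U φ →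
      ∫ x in U, f x • gradient φ x = - ∫ x in U, φ x • G x

/-- `f ∈ W₀^{1,2}(U)` with weak gradient `G`: the pair `(f, G)` is a limit in `L²(U)` of pairs
`(φ_k, Dφ_k)` with `φ_k ∈ C₀^∞(U)`. For bounded `U` this is the completion of `C₀^∞(U)` in the
norm `‖Dφ‖_{L²(U)}`, by the Poincaré inequality. -/
def IsW12Zero (U : Set (EuclideanSpace ℝ (Fin n)))
    (f : EuclideanSpace ℝ (Fin n) → ℝ)
    (G : EuclideanSpace ℝ (Fin n) → EuclideanSpace ℝ (Fin n)) : Prop :=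
  MemLp f 2 (volume.restrict U) ∧ MemLp G 2 (volume.restrict U) ∧
    ∃ φ : ℕ → EuclideanSpace ℝ (Fin n) → ℝ, (∀ k, IsTestFunction U (φ k)) ∧
      Tendsto (fun k => eLpNorm (fun x => φ k x - f x) 2 (volume.restrict U)) atTop (𝓝 0) ∧
      Tendsto (fun k => eLpNorm (fun x => gradient (φ k) x - G x) 2 (volume.restrict U))
        atTop (𝓝 0)

/-- `v ∈ L²((a,b); W^{1,2}(U))` with spatial weak gradient `Dv`. -/
structure MemL2W12 (U : Set (EuclideanSpace ℝ (Fin n))) (a b : ℝ)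
    (v : EuclideanSpace ℝ (Fin n) × ℝ → ℝ)
    (Dv : EuclideanSpace ℝ (Fin n) × ℝ → EuclideanSpace ℝ (Fin n)) : Prop where
  memLp : MemLp v 2 (volume.restrict (U ×ˢ Set.Ioo a b))
  memLp_grad : MemLp Dv 2 (volume.restrict (U ×ˢ Set.Ioo a b))
  weakGradient : ∀ᵐ t ∂(volume.restrict (Set.Ioo a b)),
    HasWeakGradient U (fun x => v (x, t)) (fun x => Dv (x, t))

/-- `w ∈ L²((a,b); W₀^{1,2}(U))` with spatial weak gradient `Dw`. -/
structure MemL2W12Zero (U : Set (EuclideanSpace ℝ (Fin n))) (a b : ℝ)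
    (w : EuclideanSpace ℝ (Fin n) × ℝ → ℝ)
    (Dw : EuclideanSpace ℝ (Fin n) × ℝ → EuclideanSpace ℝ (Fin n)) : Prop where
  memLp : MemLp w 2 (volume.restrict (U ×ˢ Set.Ioo a b))
  memLp_grad : MemLp Dw 2 (volume.restrict (U ×ˢ Set.Ioo a b))
  zeroTrace : ∀ᵐ t ∂(volume.restrict (Set.Ioo a b)),
    IsW12Zero U (fun x => w (x, t)) (fun x => Dw (x, t))

/-- `v ∈ L²_loc((a,b); W^{1,2}_loc(U))` with spatial weak gradient `Dv`. -/
def MemL2W12Loc (U : Set (EuclideanSpace ℝ (Fin n))) (a b : ℝ)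
    (v : EuclideanSpace ℝ (Fin n) × ℝ → ℝ)
    (Dv : EuclideanSpace ℝ (Fin n) × ℝ → EuclideanSpace ℝ (Fin n)) : Prop :=
  ∀ (U' : Set (EuclideanSpace ℝ (Fin n))) (a' b' : ℝ),
    IsOpen U' → IsCompact (closure U') → closure U' ⊆ U → a < a' → a' < b' → b' < b →
      MemL2W12 U' a' b' v Dv

/-- `V : [a,b] → L²(U)` is continuous and `V(t) = v(·,t)` for almost every `t ∈ (a,b)`: the
function `v` belongs to `C⁰([a,b]; L²(U))` and `V` is its continuous representative. The values of
`V` outside `[a,b]` play no role. -/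
def IsContRep (U : Set (EuclideanSpace ℝ (Fin n))) (a b : ℝ)
    (v : EuclideanSpace ℝ (Fin n) × ℝ → ℝ)
    (V : ℝ → Lp ℝ 2 (volume.restrict U)) : Prop :=
  ContinuousOn V (Set.Icc a b) ∧
    ∀ᵐ t ∂(volume.restrict (Set.Ioo a b)),
      (V t : EuclideanSpace ℝ (Fin n) → ℝ) =ᵐ[volume.restrict U] fun x => v (x, t)

/-- The weak formulation of `∂_t v = div [D_ξ F(Dv)]` in `U × (a,b)`:
`∬ (v ∂_t φ - ⟨D_ξ F(Dv), Dφ⟩) dx dt = 0` for all `φ ∈ C₀^∞(U × (a,b))`. -/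
def SatisfiesWeakEq (F : EuclideanSpace ℝ (Fin n) → ℝ)
    (U : Set (EuclideanSpace ℝ (Fin n))) (a b : ℝ)
    (v : EuclideanSpace ℝ (Fin n) × ℝ → ℝ)
    (Dv : EuclideanSpace ℝ (Fin n) × ℝ → EuclideanSpace ℝ (Fin n)) : Prop :=
  ∀ φ : EuclideanSpace ℝ (Fin n) × ℝ → ℝ, IsTestFunction (U ×ˢ Set.Ioo a b) φ →
    ∫ z in U ×ˢ Set.Ioo a b,
      (v z * deriv (fun s => φ (z.1, s)) z.2
        - inner ℝ (gradient F (Dv z)) (gradient (fun y => φ (y, z.2)) z.1)) = 0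

/-- `u ∈ L²_loc(I; W^{1,2}_loc(Ω))`, with spatial gradient `Du`, is a local weak solution of
`∂_t u = ∑_i ∂_{x_i} [(|u_{x_i}| - δ_i)_+ u_{x_i} / |u_{x_i}|]` in `Ω × I`, `I = (T₀, T₁)`. -/
structure IsLocalWeakSolution (δ : Fin n → ℝ)
    (Ω : Set (EuclideanSpace ℝ (Fin n))) (T₀ T₁ : ℝ)
    (u : EuclideanSpace ℝ (Fin n) × ℝ → ℝ)
    (Du : EuclideanSpace ℝ (Fin n) × ℝ → EuclideanSpace ℝ (Fin n)) : Prop where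
  memLoc : MemL2W12Loc Ω T₀ T₁ u Du
  weakEq : SatisfiesWeakEq (F0 δ) Ω T₀ T₁ u Du

/-- `v ∈ L²(J; W^{1,2}(Ω'))`, with spatial gradient `Dv`, is a weak solution of the
Cauchy–Dirichlet problem `∂_t v = div [D_ξ F_ε(Dv)]` in `Ω' × J`, `v = u` on `∂Ω' × J`,
`v(·,τ₀) = u(·,τ₀)` in `Ω'`, where `J = (τ₀, τ₁)`.

That `∂_t v ∈ L²(J; W^{-1,2}(Ω'))` is contained in `weakEq`, since `D_ξ F_ε(Dv)` lies in
`L²(Ω' × J)`. The initial condition is taken in the `L²` sense: `v(·,t) - u(·,t) → 0` in `L²(Ω')`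
as `t ↓ τ₀`, where the limit is an essential one (`t` outside a null set) because `u` and `v` are
determined almost everywhere only. For the continuous representatives in `C⁰([τ₀,τ₁]; L²(Ω'))`
this says that their values at `τ₀` coincide. -/
structure IsCauchyDirichletSolution (δ : Fin n → ℝ) (ε : ℝ)
    (Ω' : Set (EuclideanSpace ℝ (Fin n))) (τ₀ τ₁ : ℝ)
    (u : EuclideanSpace ℝ (Fin n) × ℝ → ℝ)
    (Du : EuclideanSpace ℝ (Fin n) × ℝ → EuclideanSpace ℝ (Fin n))
    (v : EuclideanSpace ℝ (Fin n) × ℝ → ℝ)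
    (Dv : EuclideanSpace ℝ (Fin n) × ℝ → EuclideanSpace ℝ (Fin n)) : Prop where
  mem : MemL2W12 Ω' τ₀ τ₁ v Dv
  cont : ∃ V : ℝ → Lp ℝ 2 (volume.restrict Ω'), IsContRep Ω' τ₀ τ₁ v V
  weakEq : SatisfiesWeakEq (FEps δ ε) Ω' τ₀ τ₁ v Dv
  lateral : MemL2W12Zero Ω' τ₀ τ₁ (fun z => v z - u z) (fun z => Dv z - Du z)
  initial : Tendsto
    (fun t => eLpNorm (fun x => v (x, t) - u (x, t)) 2 (volume.restrict Ω'))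
    (𝓝[>] τ₀ ⊓ ae volume) (𝓝 0)

end Spaces

/-! ### Calculus of the one-dimensional integrands -/

section ScalarCalculus

/-! The difference `w = u_ε - u` has zero lateral and initial values and solves `∂_t w = div A`
weakly, with `A = DF_ε(Du_ε) - DF_0(Du)` in `L²`. Testing with `w` itself gives `‖w(τ₁)‖² = -2 ∬ ⟨A,
Dw⟩`, so everything rests on a lower bound for `⟨A, Dw⟩` and on a proof that such testing is
legitimate.

Lower bound (`le_inner_gradient_sub`). Cauchy–Schwarz for `∫ √g̃''` gives `|K(x) - K(y)|² ≤ (g̃'(x)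
- g̃'(y))(x - y)`. Replacing `g̃'(y)` by `g'(y)` costs at most `ε/4`, and the term `εξ` of the
regularized flux supplies `ε|Dw|²`. Young's inequality absorbs the errors and leaves `ε(|Du|² +
n/16)`. This yields the energy estimate with `c = n + 2`, and the gradient bound follows from it by
the triangle inequality. Convergence of `K_ε(∂_j u_ε)` follows since `|K_ε - H_δ| ≤ 2ε` uniformly.

Testing with `w` (`exists_isContRep_energy_identity`). No dual space is used. Product test functions
show that `t ↦ ⟨w(t), ψ⟩` is almost everywhere a primitive of `-⟨A, Dψ⟩`. Separability provides one
full-measure set of times for all `ψ`, and passing to limits allows `ψ = w(r)`. Writing `‖w(r+h)‖² -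
‖w(r)‖²` as `⟨w(r+h) - w(r), w(r+h) + w(r)⟩`, dividing by `h` and integrating in `r`, one obtains
the identity at almost all times, from Lebesgue differentiation and continuity of translations in
`L²`. The identity then bounds the oscillation of `w` by a continuous function, so `w` extends
continuously to the closed interval and the identity holds at the end points. -/

theorem hasDerivAt_max_zero_sq (x : ℝ) :
    HasDerivAt (fun y : ℝ => max y 0 ^ 2) (2 * max x 0) x := by
  rcases lt_trichotomy x 0 with hx | hx | hx
  · rw [max_eq_right hx.le, mul_zero]
    refine (hasDerivAt_const x (0 : ℝ)).congr_of_eventuallyEq ?_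
    filter_upwards [gt_mem_nhds hx] with y hy
    simp [max_eq_right hy.le]
  · subst hx
    rw [hasDerivAt_iff_isLittleO_nhds_zero]
    simp only [zero_add, max_self, mul_zero, smul_zero, sub_zero, ne_eq, OfNat.ofNat_ne_zero,
      not_false_eq_true, zero_pow]
    refine Asymptotics.IsBigO.trans_isLittleO (g := fun h : ℝ => h ^ 2) ?_ ?_
    · refine Asymptotics.IsBigO.of_bound 1 (Eventually.of_forall fun h => ?_)
      rw [one_mul, Real.norm_eq_abs, Real.norm_eq_abs, abs_of_nonneg (by positivity),
        abs_of_nonneg (by positivity)]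
      rcases le_total h 0 with hh | hh
      · rw [max_eq_right hh]; nlinarith [sq_nonneg h]
      · rw [max_eq_left hh]
    · exact Asymptotics.isLittleO_pow_id one_lt_two
  · rw [max_eq_left hx.le]
    have h : HasDerivAt (fun y : ℝ => y ^ 2) (2 * x) x := by simpa using hasDerivAt_pow 2 x
    refine h.congr_of_eventuallyEq ?_
    filter_upwards [lt_mem_nhds hx] with y hy
    simp [max_eq_left (le_of_lt hy)]

/-- Because `y · y₊² = y₊³`, the product rule reduces this to the square, with no new case at the
origin. -/
theorem hasDerivAt_max_zero_cube (x : ℝ) :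
    HasDerivAt (fun y : ℝ => max y 0 ^ 3) (3 * max x 0 ^ 2) x := by
  have h := (hasDerivAt_id x).mul (hasDerivAt_max_zero_sq x)
  have e : ∀ y : ℝ, y * max y 0 ^ 2 = max y 0 ^ 3 := fun y => by
    rcases le_total y 0 with hy | hy
    · simp [max_eq_right hy]
    · simp only [max_eq_left hy]; ring
  have e2 : ∀ y : ℝ, y * max y 0 = max y 0 ^ 2 := fun y => by
    rcases le_total y 0 with hy | hy
    · simp [max_eq_right hy]
    · simp only [max_eq_left hy]; ring
  refine (h.congr_deriv ?_).congr_of_eventuallyEq (Eventually.of_forall fun y => ?_)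
  · simp only [id]; linear_combination 2 * e2 x
  · simp [e]

/-- The derivative of `gDeg`. -/
noncomputable def gDegD (d s : ℝ) : ℝ := max (s - d) 0 - max (-s - d) 0

theorem gDeg_eq {d : ℝ} (hd : 0 ≤ d) (s : ℝ) :
    gDeg d s = (1 / 2) * (max (s - d) 0 ^ 2 + max (-s - d) 0 ^ 2) := by
  unfold gDeg
  rcases le_total s 0 with hs | hs
  · rw [abs_of_nonpos hs, max_eq_right (by linarith : s - d ≤ 0)]; ring
  · rw [abs_of_nonneg hs, max_eq_right (by linarith : -s - d ≤ 0)]; ring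

theorem hasDerivAt_gDeg {d : ℝ} (hd : 0 ≤ d) (s : ℝ) : HasDerivAt (gDeg d) (gDegD d s) s := by
  rw [funext (gDeg_eq hd)]
  have h1 := (hasDerivAt_max_zero_sq (s - d)).comp s ((hasDerivAt_id s).sub_const d)
  have h2 := (hasDerivAt_max_zero_sq (-s - d)).comp s ((hasDerivAt_neg s).sub_const d)
  refine ((h1.add h2).const_mul (1 / 2)).congr_deriv ?_
  unfold gDegD; ring

theorem HFun_eq {d : ℝ} (hd : 0 ≤ d) (s : ℝ) : HFun d s = gDegD d s := by
  unfold HFun gDegD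
  split_ifs with h
  · simp [h]
  · rcases lt_or_gt_of_ne h with hs | hs
    · rw [abs_of_neg hs, max_eq_right (by linarith : s - d ≤ 0), div_neg, div_self h]; ring
    · rw [abs_of_pos hs, max_eq_right (by linarith : -s - d ≤ 0), div_self h]; ring

/-- Truncated powers make the gluing points disappear, so derivatives can be computed termwise. In
the outer region, with `t = |s| - d`, one uses `(t+ε)³ - (t-ε)³ = 6εt² + 2ε³`. Since `ε < d`, the
terms belonging to `s` and to `-s` are never active together. -/
theorem gEps_eq {d ε : ℝ} (hε : 0 < ε) (hd : ε < d) (s : ℝ) :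
    gEps d ε s = (1 / (12 * ε)) * (max (s - d + ε) 0 ^ 3 - max (s - d - ε) 0 ^ 3
      + (max (-s - d + ε) 0 ^ 3 - max (-s - d - ε) 0 ^ 3)) := by
  have key : ∀ x : ℝ, 0 ≤ x → gEps d ε x =
      (1 / (12 * ε)) * (max (x - d + ε) 0 ^ 3 - max (x - d - ε) 0 ^ 3) := by
    intro x hx
    unfold gEps
    rw [abs_of_nonneg hx]
    split_ifs with h1 h2
    · rw [max_eq_right (by linarith), max_eq_right (by linarith)]; ring
    · rw [max_eq_left (by linarith), max_eq_right (by linarith)]; ring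
    · rw [max_eq_left (by linarith), max_eq_left (by linarith)]; field_simp; ring
  rcases le_total s 0 with hs | hs
  · have := key (-s) (by linarith)
    have e : gEps d ε (-s) = gEps d ε s := by unfold gEps; simp
    rw [← e, this, max_eq_right (by linarith : s - d + ε ≤ 0),
      max_eq_right (by linarith : s - d - ε ≤ 0)]; ring
  · rw [key s hs, max_eq_right (by linarith : -s - d + ε ≤ 0),
      max_eq_right (by linarith : -s - d - ε ≤ 0)]; ring

/-- The derivative of `gTilde`. -/
noncomputable def gTildeD (d ε s : ℝ) : ℝ :=
  if d = 0 then s else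
    (1 / (4 * ε)) * (max (s - d + ε) 0 ^ 2 - max (s - d - ε) 0 ^ 2
      - (max (-s - d + ε) 0 ^ 2 - max (-s - d - ε) 0 ^ 2))

/-- The second derivative of `gTilde`. -/
noncomputable def gTildeDD (d ε s : ℝ) : ℝ :=
  if d = 0 then 1 else
    (1 / (2 * ε)) * (max (s - d + ε) 0 - max (s - d - ε) 0
      + (max (-s - d + ε) 0 - max (-s - d - ε) 0))

theorem gDegD_zero (s : ℝ) : gDegD 0 s = s := by
  unfold gDegD
  rcases le_total s 0 with hs | hs
  · rw [max_eq_right (by linarith), max_eq_left (by linarith)]; ring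
  · rw [max_eq_left (by linarith), max_eq_right (by linarith)]; ring

theorem hasDerivAt_gTilde {d ε : ℝ} (hε : 0 < ε) (hd0 : 0 ≤ d) (hd : 0 < d → ε < d) (s : ℝ) :
    HasDerivAt (gTilde d ε) (gTildeD d ε s) s := by
  unfold gTilde gTildeD
  split_ifs with h
  · subst h
    simpa [gDegD_zero] using hasDerivAt_gDeg le_rfl s
  · have hd := hd (lt_of_le_of_ne hd0 (Ne.symm h))
    rw [funext (gEps_eq hε hd)]
    have h1 := (hasDerivAt_max_zero_cube (s - d + ε)).comp s
      (((hasDerivAt_id s).sub_const d).add_const ε)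
    have h2 := (hasDerivAt_max_zero_cube (s - d - ε)).comp s
      (((hasDerivAt_id s).sub_const d).sub_const ε)
    have h3 := (hasDerivAt_max_zero_cube (-s - d + ε)).comp s
      (((hasDerivAt_neg s).sub_const d).add_const ε)
    have h4 := (hasDerivAt_max_zero_cube (-s - d - ε)).comp s
      (((hasDerivAt_neg s).sub_const d).sub_const ε)
    refine (((h1.sub h2).add (h3.sub h4)).const_mul (1 / (12 * ε))).congr_deriv ?_
    field_simp; ring

theorem hasDerivAt_gTildeD {d ε : ℝ} (hε : 0 < ε) (s : ℝ) :
    HasDerivAt (gTildeD d ε) (gTildeDD d ε s) s := by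
  by_cases h : d = 0
  · simp only [gTildeDD, h, if_true]
    have : gTildeD 0 ε = id := by ext x; simp [gTildeD]
    rw [this]; exact hasDerivAt_id s
  · simp only [gTildeDD, h, if_false]
    have : gTildeD d ε = fun s => (1 / (4 * ε)) * (max (s - d + ε) 0 ^ 2 - max (s - d - ε) 0 ^ 2
      - (max (-s - d + ε) 0 ^ 2 - max (-s - d - ε) 0 ^ 2)) := by ext x; simp [gTildeD, h]
    rw [this]
    have h1 := (hasDerivAt_max_zero_sq (s - d + ε)).comp s
      (((hasDerivAt_id s).sub_const d).add_const ε)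
    have h2 := (hasDerivAt_max_zero_sq (s - d - ε)).comp s
      (((hasDerivAt_id s).sub_const d).sub_const ε)
    have h3 := (hasDerivAt_max_zero_sq (-s - d + ε)).comp s
      (((hasDerivAt_neg s).sub_const d).add_const ε)
    have h4 := (hasDerivAt_max_zero_sq (-s - d - ε)).comp s
      (((hasDerivAt_neg s).sub_const d).sub_const ε)
    refine (((h1.sub h2).sub (h3.sub h4)).const_mul (1 / (4 * ε))).congr_deriv ?_
    field_simp; ring

theorem deriv_deriv_gTilde {d ε : ℝ} (hε : 0 < ε) (hd0 : 0 ≤ d) (hd : 0 < d → ε < d) :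
    deriv (deriv (gTilde d ε)) = gTildeDD d ε := by
  rw [funext fun s => (hasDerivAt_gTilde hε hd0 hd s).deriv]
  exact funext fun s => (hasDerivAt_gTildeD hε s).deriv

theorem continuous_gTildeDD (d ε : ℝ) : Continuous (gTildeDD d ε) := by
  by_cases h : d = 0
  · have : gTildeDD d ε = fun _ => 1 := by ext x; simp [gTildeDD, h]
    rw [this]; fun_prop
  · have : gTildeDD d ε = fun s => (1 / (2 * ε)) * (max (s - d + ε) 0 - max (s - d - ε) 0
      + (max (-s - d + ε) 0 - max (-s - d - ε) 0)) := by ext x; simp [gTildeDD, h]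
    rw [this]; fun_prop

theorem continuous_gDegD (d : ℝ) : Continuous (gDegD d) := by unfold gDegD; fun_prop

theorem continuous_gTildeD (d : ℝ) {ε : ℝ} (hε : 0 < ε) : Continuous (gTildeD d ε) :=
  continuous_iff_continuousAt.2 fun s => (hasDerivAt_gTildeD hε s).continuousAt

theorem gTildeDD_neg (d ε s : ℝ) : gTildeDD d ε (-s) = gTildeDD d ε s := by
  unfold gTildeDD; split_ifs
  · rfl
  · simp only [neg_neg]; ring

theorem gTildeD_neg (d ε s : ℝ) : gTildeD d ε (-s) = -gTildeD d ε s := by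
  unfold gTildeD; split_ifs
  · rfl
  · simp only [neg_neg]; ring

theorem gDegD_neg (d s : ℝ) : gDegD d (-s) = -gDegD d s := by
  unfold gDegD; simp

/-- On the positive half-line, `gTildeDD` is the continuous piecewise linear ramp. -/
theorem gTildeDD_of_nonneg {d ε s : ℝ} (h0 : d ≠ 0) (hd : ε < d) (hs : 0 ≤ s) (hε : 0 < ε) :
    gTildeDD d ε s = (1 / (2 * ε)) * (max (s - d + ε) 0 - max (s - d - ε) 0) := by
  simp only [gTildeDD, h0, if_false]
  rw [max_eq_right (by linarith : -s - d + ε ≤ 0), max_eq_right (by linarith : -s - d - ε ≤ 0)]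
  ring

/-- These bounds make `KEps` nondecreasing and 1-Lipschitz. -/
theorem gTildeDD_mem {d ε : ℝ} (hε : 0 < ε) (hd0 : 0 ≤ d) (hd : 0 < d → ε < d) (s : ℝ) :
    0 ≤ gTildeDD d ε s ∧ gTildeDD d ε s ≤ 1 := by
  by_cases h : d = 0
  · simp [gTildeDD, h]
  have hd := hd (lt_of_le_of_ne hd0 (Ne.symm h))
  wlog hs : 0 ≤ s generalizing s
  · rw [← gTildeDD_neg]; exact this (-s) (by linarith)
  rw [gTildeDD_of_nonneg h hd hs hε, one_div, inv_mul_le_iff₀ (by positivity)]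
  constructor
  · refine mul_nonneg (by positivity) (sub_nonneg.2 (max_le_max (by linarith) le_rfl))
  · rcases le_total (s - d + ε) 0 with h1 | h1 <;> rcases le_total (s - d - ε) 0 with h2 | h2 <;>
      simp only [h1, h2, max_eq_left, max_eq_right] <;> linarith

theorem KEps_eq {d ε : ℝ} (hε : 0 < ε) (hd0 : 0 ≤ d) (hd : 0 < d → ε < d) (s : ℝ) :
    KEps d ε s = ∫ τ in (0 : ℝ)..s, √(gTildeDD d ε τ) := by
  rw [KEps, deriv_deriv_gTilde hε hd0 hd]

theorem continuous_sqrt_gTildeDD (d ε : ℝ) : Continuous fun τ => √(gTildeDD d ε τ) :=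
  (continuous_gTildeDD d ε).sqrt

theorem KEps_sub {d ε : ℝ} (hε : 0 < ε) (hd0 : 0 ≤ d) (hd : 0 < d → ε < d) (s t : ℝ) :
    KEps d ε t - KEps d ε s = ∫ τ in s..t, √(gTildeDD d ε τ) := by
  rw [KEps_eq hε hd0 hd, KEps_eq hε hd0 hd, intervalIntegral.integral_interval_sub_left] <;>
  exact (continuous_sqrt_gTildeDD d ε).intervalIntegrable _ _

theorem KEps_mono_lip {d ε : ℝ} (hε : 0 < ε) (hd0 : 0 ≤ d) (hd : 0 < d → ε < d) {s t : ℝ}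
    (hst : s ≤ t) : 0 ≤ KEps d ε t - KEps d ε s ∧ KEps d ε t - KEps d ε s ≤ t - s := by
  rw [KEps_sub hε hd0 hd]
  constructor
  · exact intervalIntegral.integral_nonneg hst fun _ _ => Real.sqrt_nonneg _
  · have := intervalIntegral.integral_mono_on (μ := volume) hst
      ((continuous_sqrt_gTildeDD d ε).intervalIntegrable s t)
      (intervalIntegrable_const (c := (1 : ℝ))) fun x _ => Real.sqrt_le_one.2
        (gTildeDD_mem hε hd0 hd x).2
    simpa using this

theorem KEps_zero (d ε : ℝ) : KEps d ε 0 = 0 := by simp [KEps]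

theorem abs_KEps_sub_le {d ε : ℝ} (hε : 0 < ε) (hd0 : 0 ≤ d) (hd : 0 < d → ε < d) (s t : ℝ) :
    |KEps d ε t - KEps d ε s| ≤ |t - s| := by
  rcases le_total s t with h | h
  · have := KEps_mono_lip hε hd0 hd h
    rw [abs_of_nonneg this.1, abs_of_nonneg (by linarith)]; exact this.2
  · have := KEps_mono_lip hε hd0 hd h
    rw [abs_sub_comm, abs_sub_comm t, abs_of_nonneg this.1, abs_of_nonneg (by linarith)]
    exact this.2

theorem continuous_KEps {d ε : ℝ} (hε : 0 < ε) (hd0 : 0 ≤ d) (hd : 0 < d → ε < d) :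
    Continuous (KEps d ε) := by
  have : LipschitzWith 1 (KEps d ε) := LipschitzWith.of_dist_le_mul fun x y => by
    simpa [Real.dist_eq] using abs_KEps_sub_le hε hd0 hd y x
  exact this.continuous

theorem KEps_neg {d ε : ℝ} (hε : 0 < ε) (hd0 : 0 ≤ d) (hd : 0 < d → ε < d) (s : ℝ) :
    KEps d ε (-s) = -KEps d ε s := by
  rw [KEps_eq hε hd0 hd, KEps_eq hε hd0 hd, ← intervalIntegral.integral_symm]
  have := intervalIntegral.integral_comp_neg (a := s) (b := 0) fun τ => √(gTildeDD d ε τ)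
  simp only [gTildeDD_neg, neg_zero] at this
  exact this.symm

/-- The square of the integral of a square root is controlled by the Cauchy–Schwarz inequality. -/
theorem sq_integral_sqrt_le {k : ℝ → ℝ} (hk : Continuous k) (h0 : ∀ x, 0 ≤ k x) {a b : ℝ}
    (hab : a < b) : (∫ τ in a..b, √(k τ)) ^ 2 ≤ (∫ τ in a..b, k τ) * (b - a) := by
  have hba : 0 < b - a := sub_pos.2 hab
  set S := ∫ τ in a..b, √(k τ) with hS
  -- With `m` the mean of `√k`, the claim is the nonnegativity of `∫ (√k - m)² = ∫ k - S²/(b - a)`.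
  set m := S / (b - a) with hm
  have hi : 0 ≤ ∫ τ in a..b, (√(k τ) - m) ^ 2 :=
    intervalIntegral.integral_nonneg hab.le fun _ _ => sq_nonneg _
  have hsq : Continuous fun τ => √(k τ) := hk.sqrt
  have e : ∫ τ in a..b, (√(k τ) - m) ^ 2 = (∫ τ in a..b, k τ) - 2 * m * S + (b - a) * m ^ 2 := by
    have : ∀ τ, (√(k τ) - m) ^ 2 = k τ - 2 * m * √(k τ) + m ^ 2 := fun τ => by
      have := Real.sq_sqrt (h0 τ); linear_combination this
    simp only [this]
    rw [intervalIntegral.integral_add, intervalIntegral.integral_sub,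
      intervalIntegral.integral_const_mul, intervalIntegral.integral_const, smul_eq_mul]
    all_goals exact Continuous.intervalIntegrable (by fun_prop) _ _
  rw [e] at hi
  have hSm : S = m * (b - a) := by rw [hm]; field_simp
  rw [hSm] at hi ⊢
  nlinarith

/-- Cauchy–Schwarz on the interval between `s` and `t`, over which `g̃''` integrates to the
increment of `g̃'`. This is why `K` is built from the square root of `g̃''`: its increments measure
the monotonicity of the flux. -/
theorem KEps_sub_sq_le {d ε : ℝ} (hε : 0 < ε) (hd0 : 0 ≤ d) (hd : 0 < d → ε < d) (s t : ℝ) :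
    (KEps d ε t - KEps d ε s) ^ 2 ≤ (gTildeD d ε t - gTildeD d ε s) * (t - s) := by
  wlog h : s < t generalizing s t
  · rcases (not_lt.1 h).eq_or_lt with h | h
    · simp [h]
    · have := this t s h
      nlinarith
  rw [KEps_sub hε hd0 hd]
  have := sq_integral_sqrt_le (continuous_gTildeDD d ε) (fun x => (gTildeDD_mem hε hd0 hd x).1) h
  rwa [intervalIntegral.integral_eq_sub_of_hasDerivAt (f := gTildeD d ε)
    (fun x _ => hasDerivAt_gTildeD hε x)
    ((continuous_gTildeDD d ε).intervalIntegrable _ _)] at this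

/-- For `d > 0` the two derivatives differ only where `x = |s| - d` lies in `(-ε, ε)`. There one
compares `(x+ε)²/(4ε)` with `x₊`, and the gap is largest at `x = 0`, where it equals `ε/4`. -/
theorem abs_gTildeD_sub_gDegD_le {d ε : ℝ} (hε : 0 < ε) (hd0 : 0 ≤ d) (hd : 0 < d → ε < d)
    (s : ℝ) : |gTildeD d ε s - gDegD d s| ≤ ε / 4 := by
  by_cases h : d = 0
  · subst h; simp only [gDegD_zero, gTildeD, if_true, sub_self, abs_zero]; positivity
  have hd := hd (lt_of_le_of_ne hd0 (Ne.symm h))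
  wlog hs : 0 ≤ s generalizing s
  · have := this (-s) (by linarith)
    rwa [gTildeD_neg, gDegD_neg, neg_sub_neg, abs_sub_comm] at this
  simp only [gTildeD, h, if_false, gDegD]
  rw [max_eq_right (by linarith : -s - d + ε ≤ 0), max_eq_right (by linarith : -s - d - ε ≤ 0),
    max_eq_right (by linarith : -s - d ≤ 0)]
  set x := s - d with hx
  have e : ∀ A B : ℝ, 1 / (4 * ε) * (A - B) = (A - B) / (4 * ε) := fun A B => by ring
  have hb : ∀ A B : ℝ, A * (4 * ε) ≤ B → B ≤ A * (4 * ε) + ε ^ 2 →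
      |1 / (4 * ε) * B - A| ≤ ε / 4 := by
    intro A B h1 h2
    have : 1 / (4 * ε) * B - A = (B - A * (4 * ε)) / (4 * ε) := by field_simp
    rw [this, abs_of_nonneg (by apply div_nonneg <;> linarith), div_le_iff₀ (by positivity)]
    linarith
  have := hb (max x 0) (max (x + ε) 0 ^ 2 - max (x - ε) 0 ^ 2) ?_ ?_
  · simpa using this
  all_goals
    rcases le_total x 0 with h1 | h1 <;> rcases le_total (x + ε) 0 with h2 | h2 <;>
      rcases le_total (x - ε) 0 with h3 | h3 <;>
      simp only [h1, h2, h3, max_eq_left, max_eq_right] <;> nlinarith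

theorem abs_gDegD_le {d : ℝ} (hd : 0 ≤ d) (s : ℝ) : |gDegD d s| ≤ |s| := by
  unfold gDegD
  rcases le_total s 0 with hs | hs
  · rw [max_eq_right (by linarith : s - d ≤ 0), abs_of_nonpos hs, zero_sub, abs_neg,
      abs_of_nonneg (le_max_right _ _)]
    exact max_le (by linarith) (by linarith)
  · rw [max_eq_right (by linarith : -s - d ≤ 0), abs_of_nonneg hs, sub_zero,
      abs_of_nonneg (le_max_right _ _)]
    exact max_le (by linarith) (by linarith)

/-- For `d > 0` and `s ≥ 0`, both functions vanish up to `d - ε` and have slope one beyond `d + ε`.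
On the window between, of length `2ε`, both are nondecreasing and 1-Lipschitz. Oddness covers `s <
0`. -/
theorem abs_KEps_sub_gDegD_le {d ε : ℝ} (hε : 0 < ε) (hd0 : 0 ≤ d) (hd : 0 < d → ε < d)
    (s : ℝ) : |KEps d ε s - gDegD d s| ≤ 2 * ε := by
  by_cases h : d = 0
  · subst h; rw [gDegD_zero, KEps_eq hε hd0 hd]
    simp [gTildeDD, hε.le]
  have hd' := hd (lt_of_le_of_ne hd0 (Ne.symm h))
  wlog hs : 0 ≤ s generalizing s
  · have := this (-s) (by linarith)
    rwa [KEps_neg hε hd0 hd, gDegD_neg, neg_sub_neg, abs_sub_comm] at this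
  have hzero : ∀ x, 0 ≤ x → x ≤ d - ε → KEps d ε x = 0 := by
    intro x hx0 hx
    rw [KEps_eq hε hd0 hd]
    refine (intervalIntegral.integral_congr (g := fun _ => (0 : ℝ)) fun τ hτ => ?_).trans (by simp)
    rw [Set.uIcc_of_le hx0] at hτ
    simp only
    rw [gTildeDD_of_nonneg h hd' hτ.1 hε, max_eq_right (by linarith [hτ.2]),
      max_eq_right (by linarith [hτ.2])]
    simp
  unfold gDegD
  rw [max_eq_right (by linarith : -s - d ≤ 0), sub_zero]
  rcases le_total s (d - ε) with h1 | h1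
  · rw [hzero s hs h1, max_eq_right (by linarith)]; simp; exact hε.le
  have hK0 := hzero (d - ε) (by linarith) le_rfl
  rcases le_total s (d + ε) with h2 | h2
  · have := KEps_mono_lip hε hd0 hd h1
    rw [hK0] at this
    rw [abs_le]
    rcases le_total (s - d) 0 with h3 | h3
    · rw [max_eq_right h3]; constructor <;> linarith
    · rw [max_eq_left h3]; constructor <;> linarith
  · have := KEps_mono_lip hε hd0 hd (show d - ε ≤ d + ε by linarith)
    rw [hK0] at this
    have h3 : KEps d ε s - KEps d ε (d + ε) = s - (d + ε) := by
      rw [KEps_sub hε hd0 hd]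
      refine (intervalIntegral.integral_congr (g := fun _ => (1 : ℝ)) fun τ hτ => ?_).trans
        (by simp)
      rw [Set.uIcc_of_le h2] at hτ
      simp only
      rw [gTildeDD_of_nonneg h hd' (by linarith [hτ.1]) hε, max_eq_left (by linarith [hτ.1]),
        max_eq_left (by linarith [hτ.1])]
      have : 1 / (2 * ε) * (τ - d + ε - (τ - d - ε)) = 1 := by field_simp; ring
      rw [this, Real.sqrt_one]
    rw [max_eq_left (by linarith), abs_le]
    constructor <;> linarith

end ScalarCalculus

/-! ### Gradients of the integrands `F_0` and `F_ε` -/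

section Gradients

variable {n : ℕ}

theorem hasGradientAt_sum_comp_apply {f : Fin n → ℝ → ℝ} {f' : Fin n → ℝ}
    {ξ : EuclideanSpace ℝ (Fin n)} (h : ∀ i, HasDerivAt (f i) (f' i) (ξ i)) :
    HasGradientAt (fun ξ : EuclideanSpace ℝ (Fin n) => ∑ i, f i (ξ i)) (WithLp.toLp 2 f') ξ := by
  rw [hasGradientAt_iff_hasFDerivAt]
  have h1 : ∀ i, HasFDerivAt (fun ξ : EuclideanSpace ℝ (Fin n) => f i (ξ i))
      (f' i • (EuclideanSpace.proj i : EuclideanSpace ℝ (Fin n) →L[ℝ] ℝ)) ξ := fun i =>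
    (h i).comp_hasFDerivAt ξ (EuclideanSpace.proj i : EuclideanSpace ℝ (Fin n) →L[ℝ] ℝ).hasFDerivAt
  refine (HasFDerivAt.fun_sum fun i _ => h1 i).congr_fderiv ?_
  ext v
  simp [PiLp.inner_apply, mul_comm]

theorem gradient_F0 {δ : Fin n → ℝ} (hδ : ∀ i, 0 ≤ δ i) (ξ : EuclideanSpace ℝ (Fin n)) :
    gradient (F0 δ) ξ = WithLp.toLp 2 fun i => gDegD (δ i) (ξ i) :=
  (hasGradientAt_sum_comp_apply fun i => hasDerivAt_gDeg (hδ i) (ξ i)).gradient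

theorem gradient_FEps {δ : Fin n → ℝ} {ε : ℝ} (hδ : ∀ i, 0 ≤ δ i) (hε : AdmissibleEps δ ε)
    (ξ : EuclideanSpace ℝ (Fin n)) :
    gradient (FEps δ ε) ξ = WithLp.toLp 2 fun i => gTildeD (δ i) ε (ξ i) + ε * ξ i := by
  have e : FEps δ ε = fun ξ : EuclideanSpace ℝ (Fin n) =>
      ∑ i, (gTilde (δ i) ε (ξ i) + ε / 2 * ξ i ^ 2) + ε / 2 := by
    ext ξ
    rw [FEps, EuclideanSpace.norm_sq_eq, Finset.sum_add_distrib, ← Finset.mul_sum]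
    simp only [Real.norm_eq_abs, sq_abs]; ring
  rw [e]
  refine HasGradientAt.gradient ?_
  have h := hasGradientAt_sum_comp_apply (ξ := ξ)
    (f := fun i s => gTilde (δ i) ε s + ε / 2 * s ^ 2)
    (f' := fun i => gTildeD (δ i) ε (ξ i) + ε * ξ i) fun i => by
      refine ((hasDerivAt_gTilde hε.1 (hδ i) (hε.2.2 i) (ξ i)).add
        ((hasDerivAt_pow 2 (ξ i)).const_mul (ε / 2))).congr_deriv ?_
      simp; ring
  rw [hasGradientAt_iff_hasFDerivAt] at h ⊢
  exact h.add_const _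

end Gradients

/-! ### Functions of one variable with a given weak derivative -/

section DuBoisReymond

theorem IsTestFunction.support_subset {X : Type*} [NormedAddCommGroup X] [NormedSpace ℝ X]
    {U : Set X} {φ : X → ℝ} (h : IsTestFunction U φ) : Function.support φ ⊆ U :=
  (subset_tsupport φ).trans h.2.2

theorem IsTestFunction.eq_zero {X : Type*} [NormedAddCommGroup X] [NormedSpace ℝ X]
    {U : Set X} {φ : X → ℝ} (h : IsTestFunction U φ) {x : X} (hx : x ∉ U) : φ x = 0 := by
  by_contra h0
  exact hx (h.support_subset h0)

theorem IsTestFunction.bounded {X : Type*} [NormedAddCommGroup X] [NormedSpace ℝ X]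
    {U : Set X} {φ : X → ℝ} (h : IsTestFunction U φ) : ∃ C, ∀ x, ‖φ x‖ ≤ C :=
  h.2.1.exists_bound_of_continuous h.1.continuous

theorem exists_isTestFunction_integral_eq_one {a b : ℝ} (hab : a < b) :
    ∃ χ : ℝ → ℝ, IsTestFunction (Set.Ioo a b) χ ∧ ∫ t, χ t = 1 := by
  obtain ⟨c, hc⟩ := exists_between hab
  obtain ⟨r, hr, hrs⟩ := Metric.nhds_basis_closedBall.mem_iff.1 (Ioo_mem_nhds hc.1 hc.2)
  let f : ContDiffBump c := ⟨r / 2, r, by positivity, by linarith⟩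
  refine ⟨f.normed volume, ⟨f.contDiff_normed, f.hasCompactSupport_normed, ?_⟩,
    f.integral_normed⟩
  rw [f.tsupport_normed_eq]
  exact hrs

/-- A test function on an interval with vanishing integral is the derivative of a test
function. -/
theorem exists_isTestFunction_deriv_eq {a b : ℝ} (hab : a < b) {κ : ℝ → ℝ}
    (hκ : IsTestFunction (Set.Ioo a b) κ) (h0 : ∫ t, κ t = 0) :
    ∃ χ : ℝ → ℝ, IsTestFunction (Set.Ioo a b) χ ∧ deriv χ = κ := by
  obtain ⟨m, hm⟩ := exists_between hab
  -- Adjoining `m` keeps the compact set nonempty even for `κ = 0`, so its infimum and supremum lie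
  -- in `(a, b)`.
  have hK : IsCompact (tsupport κ ∪ {m}) := hκ.2.1.isCompact.union isCompact_singleton
  have hKs : tsupport κ ∪ {m} ⊆ Set.Ioo a b :=
    Set.union_subset hκ.2.2 (Set.singleton_subset_iff.2 hm)
  have hKn : (tsupport κ ∪ {m}).Nonempty := ⟨m, Or.inr rfl⟩
  have hp := hKs (hK.sInf_mem hKn)
  have hq := hKs (hK.sSup_mem hKn)
  set p := sInf (tsupport κ ∪ {m})
  set q := sSup (tsupport κ ∪ {m})
  have hsup : Function.support κ ⊆ Set.Icc p q := fun x hx =>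
    ⟨csInf_le hK.bddBelow (Or.inl (subset_tsupport κ hx)),
      le_csSup hK.bddAbove (Or.inl (subset_tsupport κ hx))⟩
  have hc : Continuous κ := hκ.1.continuous
  have hd : ∀ t, HasDerivAt (fun t => ∫ s in a..t, κ s) (κ t) t := fun t =>
    intervalIntegral.integral_hasDerivAt_right (hc.intervalIntegrable _ _)
      hc.aestronglyMeasurable.stronglyMeasurableAtFilter hc.continuousAt
  have hde : deriv (fun t => ∫ s in a..t, κ s) = κ := funext fun t => (hd t).deriv
  -- To the left of `p` nothing has been integrated yet; to the right of `q` the whole vanishing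
  -- integral has.
  have hz : ∀ t, t ∉ Set.Icc p q → ∫ s in a..t, κ s = 0 := by
    intro t ht
    rw [Set.mem_Icc, not_and_or, not_le, not_le] at ht
    rcases ht with ht | ht
    · refine (intervalIntegral.integral_congr (g := fun _ => (0 : ℝ)) fun s hs => ?_).trans
        (by simp)
      by_contra hne
      have h1 := (hsup hne).1
      have h2 := hs.2
      rcases max_cases a t with h | h <;> linarith [hp.1]
    · rw [intervalIntegral.integral_eq_integral_of_support_subset, h0]
      exact hsup.trans fun x hx => ⟨hp.1.trans_le hx.1, hx.2.trans ht.le⟩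
  have hts : tsupport (fun t => ∫ s in a..t, κ s) ⊆ Set.Icc p q :=
    closure_minimal (fun x hx => by by_contra h; exact hx (hz x h)) isClosed_Icc
  refine ⟨fun t => ∫ s in a..t, κ s, ⟨?_, ?_, ?_⟩, hde⟩
  · rw [contDiff_infty_iff_deriv, hde]
    exact ⟨fun t => (hd t).differentiableAt, hκ.1⟩
  · exact HasCompactSupport.of_support_subset_isCompact isCompact_Icc
      ((subset_tsupport _).trans hts)
  · exact hts.trans fun x hx => ⟨hp.1.trans_le hx.1, hx.2.trans_lt hq.2⟩

/-- A function on an interval whose weak derivative vanishes is almost everywhere constant. -/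
theorem exists_ae_eq_const_of_integral_mul_deriv_eq_zero {a b : ℝ} (hab : a < b) {F : ℝ → ℝ}
    (hF : IntegrableOn F (Set.Ioo a b))
    (h : ∀ χ : ℝ → ℝ, IsTestFunction (Set.Ioo a b) χ →
      ∫ t in Set.Ioo a b, F t * deriv χ t = 0) :
    ∃ c : ℝ, ∀ᵐ t ∂volume.restrict (Set.Ioo a b), F t = c := by
  obtain ⟨χ₀, hχ₀, h1⟩ := exists_isTestFunction_integral_eq_one hab
  set c := ∫ t in Set.Ioo a b, F t * χ₀ t with hcdef
  refine ⟨c, ?_⟩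
  have hint : ∀ η : ℝ → ℝ, IsTestFunction (Set.Ioo a b) η →
      IntegrableOn (fun t => F t * η t) (Set.Ioo a b) := by
    intro η hη
    obtain ⟨C, hC⟩ := hη.bounded
    exact hF.mul_bdd hη.1.continuous.aestronglyMeasurable (Eventually.of_forall hC)
  have hFc : IntegrableOn (fun t => F t - c) (Set.Ioo a b) := hF.sub (integrable_const c)
  have key := isOpen_Ioo.ae_eq_zero_of_integral_contDiff_smul_eq_zero
    (f := fun t => F t - c) (μ := volume) (U := Set.Ioo a b) hFc.locallyIntegrableOn ?_
  · rw [ae_restrict_iff' measurableSet_Ioo]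
    filter_upwards [key] with t ht hmem
    linarith [ht hmem]
  · intro η hη1 hη2 hη3
    have hη : IsTestFunction (Set.Ioo a b) η := ⟨hη1, hη2, hη3⟩
    -- Subtracting the multiple of `χ₀` with the same integral makes `η` admissible as a derivative
    -- `χ'`; testing with that `χ` says exactly `∫ (F - c) η = 0`.
    have hκ : IsTestFunction (Set.Ioo a b) (fun t => η t - (∫ s, η s) * χ₀ t) := by
      refine ⟨hη1.sub (contDiff_const.mul hχ₀.1), ?_, ?_⟩
      · exact hη2.sub hχ₀.2.1.mul_left
      · refine (tsupport_sub _ _).trans (Set.union_subset hη3 ?_)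
        exact (closure_mono (Function.support_mul_subset_right _ _)).trans hχ₀.2.2
    have hi1 : Integrable η := hη1.continuous.integrable_of_hasCompactSupport hη2
    have hi2 : Integrable χ₀ := hχ₀.1.continuous.integrable_of_hasCompactSupport hχ₀.2.1
    obtain ⟨χ, hχ, hd⟩ := exists_isTestFunction_deriv_eq hab hκ (by
      rw [integral_sub hi1 (hi2.const_mul _), integral_const_mul, h1]; ring)
    have h2 := h χ hχ
    rw [hd] at h2
    have e1 : ∫ t in Set.Ioo a b, F t * (η t - (∫ s, η s) * χ₀ t)
        = (∫ t in Set.Ioo a b, F t * η t) - (∫ s, η s) * c := by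
      rw [hcdef, ← integral_const_mul, ← integral_sub (hint η hη) ((hint χ₀ hχ₀).const_mul _)]
      congr 1; ext t; ring
    have e2 : ∫ t, η t • (F t - c) = ∫ t in Set.Ioo a b, η t • (F t - c) := by
      rw [setIntegral_eq_integral_of_forall_compl_eq_zero]
      intro x hx
      rw [hη.eq_zero hx, zero_smul]
    have e3 : ∫ t, η t = ∫ t in Set.Ioo a b, η t := by
      rw [setIntegral_eq_integral_of_forall_compl_eq_zero]
      intro x hx
      exact hη.eq_zero hx
    rw [e2]
    have e4 : ∫ t in Set.Ioo a b, η t • (F t - c)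
        = (∫ t in Set.Ioo a b, F t * η t) - c * ∫ t in Set.Ioo a b, η t := by
      rw [← integral_const_mul, ← integral_sub (hint η hη) (hi1.integrableOn.const_mul _)]
      congr 1; ext t; simp; ring
    rw [e4, ← e3]; linarith

/-- A function on an interval with integrable weak derivative `g` is almost everywhere a
primitive of `g`. -/
theorem exists_ae_eq_const_add_integral {a b : ℝ} (hab : a < b) {f g : ℝ → ℝ}
    (hf : IntegrableOn f (Set.Ioo a b)) (hg : IntegrableOn g (Set.Ioo a b))
    (h : ∀ χ : ℝ → ℝ, IsTestFunction (Set.Ioo a b) χ →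
      ∫ t in Set.Ioo a b, (f t * deriv χ t + g t * χ t) = 0) :
    ∃ c : ℝ, ∀ᵐ t ∂volume.restrict (Set.Ioo a b), f t = c + ∫ s in a..t, g s := by
  have hgi : IntervalIntegrable g volume a b :=
    (intervalIntegrable_iff_integrableOn_Ioo_of_le hab.le).2 hg
  set G : ℝ → ℝ := fun t => ∫ s in a..t, g s with hG
  have hGac : AbsolutelyContinuousOnInterval G a b :=
    hgi.absolutelyContinuousOnInterval_intervalIntegral (by simp)
  have hGc : ContinuousOn G (Set.Icc a b) := by
    have := hGac.continuousOn
    rwa [Set.uIcc_of_le hab.le] at this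
  have hGi : IntegrableOn G (Set.Ioo a b) :=
    (hGc.integrableOn_Icc).mono_set Set.Ioo_subset_Icc_self
  -- The function `f - G` has vanishing weak derivative: `G` is absolutely continuous with `G' = g`
  -- almost everywhere, so integration by parts applies, and `χ` kills the boundary terms.
  obtain ⟨c, hc⟩ := exists_ae_eq_const_of_integral_mul_deriv_eq_zero hab (hf.sub hGi) (by
    intro χ hχ
    have hχc : ContDiff ℝ 1 χ := hχ.1.of_le (by simp)
    have hχac : AbsolutelyContinuousOnInterval χ a b :=
      hχc.contDiffOn.absolutelyContinuousOnInterval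
    have hχd : Continuous (deriv χ) := hχc.continuous_deriv le_rfl
    obtain ⟨C, hC⟩ := hχ.bounded
    obtain ⟨C', hC'⟩ := hχ.2.1.deriv.exists_bound_of_continuous hχd
    have hparts := hGac.integral_mul_deriv_eq_deriv_mul hχac
    rw [hχ.eq_zero Set.left_notMem_Ioo, hχ.eq_zero Set.right_notMem_Ioo] at hparts
    have hae : ∫ x in a..b, deriv G x * χ x = ∫ x in a..b, g x * χ x := by
      refine intervalIntegral.integral_congr_ae ?_
      filter_upwards [hgi.ae_hasDerivAt_integral] with x hx hxm
      rw [(hx (Set.uIoc_subset_uIcc hxm) a Set.left_mem_uIcc).deriv]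
    rw [hae, intervalIntegral.integral_of_le hab.le, intervalIntegral.integral_of_le hab.le,
      integral_Ioc_eq_integral_Ioo, integral_Ioc_eq_integral_Ioo] at hparts
    have i1 : IntegrableOn (fun t => f t * deriv χ t) (Set.Ioo a b) :=
      hf.mul_bdd hχd.aestronglyMeasurable (Eventually.of_forall hC')
    have i2 : IntegrableOn (fun t => g t * χ t) (Set.Ioo a b) :=
      hg.mul_bdd hχ.1.continuous.aestronglyMeasurable (Eventually.of_forall hC)
    have i3 : IntegrableOn (fun t => G t * deriv χ t) (Set.Ioo a b) :=
      hGi.mul_bdd hχd.aestronglyMeasurable (Eventually.of_forall hC')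
    have h0 := h χ hχ
    rw [integral_add i1 i2] at h0
    simp only [Pi.sub_apply, sub_mul]
    rw [integral_sub i1 i3, hparts]
    linarith)
  refine ⟨c, hc.mono fun t ht => ?_⟩
  simp only [Pi.sub_apply] at ht
  linarith

end DuBoisReymond

/-! ### Energy identity at almost every time -/

section EnergyIdentity

theorem abs_integral_inner_le {α X : Type*} [MeasurableSpace α] [NormedAddCommGroup X]
    [InnerProductSpace ℝ X] {μ : Measure α} {f g : α → X} (hf : MemLp f 2 μ) (hg : MemLp g 2 μ) :
    |∫ x, inner ℝ (f x) (g x) ∂μ| ≤ (eLpNorm f 2 μ).toReal * (eLpNorm g 2 μ).toReal := by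
  have h := abs_real_inner_le_norm (hf.toLp f) (hg.toLp g)
  rw [Lp.norm_toLp, Lp.norm_toLp, L2.inner_def] at h
  convert h using 2
  refine integral_congr_ae ?_
  filter_upwards [hf.coeFn_toLp, hg.coeFn_toLp] with x h1 h2
  rw [h1, h2]

theorem integrable_inner {α X : Type*} [MeasurableSpace α] [NormedAddCommGroup X]
    [InnerProductSpace ℝ X] {μ : Measure α} {f g : α → X} (hf : MemLp f 2 μ) (hg : MemLp g 2 μ) :
    Integrable (fun x => inner ℝ (f x) (g x)) μ := by
  refine (L2.integrable_inner (𝕜 := ℝ) (hf.toLp f) (hg.toLp g)).congr ?_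
  filter_upwards [hf.coeFn_toLp, hg.coeFn_toLp] with x h1 h2
  rw [h1, h2]

/-- The additive group of the line acts continuously on `L²` by translations, the exponent being
finite. -/
theorem tendsto_eLpNorm_translate_sub {X : Type*} [NormedAddCommGroup X] {f : ℝ → X}
    (hf : MemLp f 2 volume) :
    Tendsto (fun h : ℝ => (eLpNorm (fun t => f (t + h) - f t) 2 volume).toReal) (𝓝 0) (𝓝 0) := by
  have : Fact ((2 : ENNReal) ≠ ⊤) := ⟨by norm_num⟩
  have h1 : Continuous fun h : ℝ => (DomAddAct.mk h) +ᵥ hf.toLp f :=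
    DomAddAct.continuous_mk.vadd continuous_const
  have h2 := (h1.tendsto 0).dist (tendsto_const_nhds (x := hf.toLp f))
  have h0 : DomAddAct.mk (0 : ℝ) +ᵥ hf.toLp f = hf.toLp f := by
    simp
  rw [h0, dist_self] at h2
  refine h2.congr fun h => ?_
  rw [DomAddAct.mk_vadd_toLp, Lp.dist_edist, Lp.edist_toLp_toLp]
  simp only [vadd_eq_add, add_comm h]
  rfl

theorem memLp_comp_add_right {X : Type*} [NormedAddCommGroup X] {f : ℝ → X}
    (hf : MemLp f 2 volume) (h : ℝ) : MemLp (fun t => f (t + h)) 2 volume :=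
  hf.comp_measurePreserving (measurePreserving_add_right volume h)

variable {H X : Type*} [NormedAddCommGroup H] [InnerProductSpace ℝ H]
  [NormedAddCommGroup X] [InnerProductSpace ℝ X]

theorem abs_intervalIntegral_inner_le {f g : ℝ → X} (hf : MemLp f 2 volume)
    (hg : MemLp g 2 volume) {s t : ℝ} (hst : s ≤ t) :
    |∫ r in s..t, inner ℝ (f r) (g r)|
      ≤ (eLpNorm f 2 volume).toReal * (eLpNorm g 2 volume).toReal := by
  rw [intervalIntegral.integral_of_le hst]
  refine (abs_integral_inner_le (hf.restrict _) (hg.restrict _)).trans ?_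
  gcongr
  · exact hf.2.ne
  · exact Measure.restrict_le_self
  · exact hg.2.ne
  · exact Measure.restrict_le_self

theorem intervalIntegrable_inner {f g : ℝ → X} (hf : MemLp f 2 volume)
    (hg : MemLp g 2 volume) (s t : ℝ) :
    IntervalIntegrable (fun r => inner ℝ (f r) (g r)) volume s t :=
  (integrable_inner hf hg).intervalIntegrable

/-- The shear `(r, σ) ↦ (r, r + σ)` preserves the product measure and reduces this to a product of
integrable functions. It justifies Fubini for the averages in `r` and `σ`. -/
theorem integrable_prod_inner_translate {A E : ℝ → X} (hA : Integrable A volume)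
    (hE : Integrable E volume) :
    Integrable (fun p : ℝ × ℝ => (inner ℝ (A (p.1 + p.2)) (E p.1) : ℝ))
      (volume.prod volume) := by
  have h1 : Integrable (fun p : ℝ × ℝ => (inner ℝ (A p.2) (E p.1) : ℝ))
      (volume.prod volume) := by
    refine ((hE.norm.mul_prod hA.norm)).mono
      (hA.1.comp_snd.inner (𝕜 := ℝ) hE.1.comp_fst) (Eventually.of_forall fun p => ?_)
    simp only [norm_mul, norm_norm, mul_comm ‖E p.1‖]
    exact norm_inner_le_norm _ _
  exact (measurePreserving_prod_add volume volume).integrable_comp_of_integrable h1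

/-- The double average `h⁻¹ ∫₀ʰ ∫ₛᵗ ⟨A(r+σ), D(r+h) + D(r)⟩ dr dσ` tends to `2 ∫ₛᵗ ⟨A, D⟩`. -/
theorem tendsto_average_integral_inner {A D : ℝ → X} (hA : MemLp A 2 volume)
    (hD : MemLp D 2 volume) (hAi : Integrable A volume) (hDi : Integrable D volume)
    {s t : ℝ} (hst : s ≤ t) :
    Tendsto (fun h : ℝ => h⁻¹ * ∫ σ in (0 : ℝ)..h,
        ∫ r in s..t, inner ℝ (A (r + σ)) (D (r + h) + D r))
      (𝓝[>] 0) (𝓝 (2 * ∫ r in s..t, inner ℝ (A r) (D r))) := by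
  set nA := (eLpNorm A 2 volume).toReal
  set nD := (eLpNorm D 2 volume).toReal
  set I := ∫ r in s..t, inner ℝ (A r) (D r)
  set oA : ℝ → ℝ := fun h => (eLpNorm (fun t => A (t + h) - A t) 2 volume).toReal with hoA
  set oD : ℝ → ℝ := fun h => (eLpNorm (fun t => D (t + h) - D t) 2 volume).toReal with hoD
  have hsum : ∀ h, (eLpNorm (fun r => D (r + h) + D r) 2 volume).toReal ≤ nD + nD := by
    intro h
    have h1 := memLp_comp_add_right hD h
    have h2 := eLpNorm_add_le h1.1 hD.1 (by norm_num : (1 : ENNReal) ≤ 2)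
    have h3 : eLpNorm (fun r => D (r + h)) 2 volume = eLpNorm D 2 volume :=
      eLpNorm_comp_measurePreserving hD.1 (measurePreserving_add_right volume h)
    rw [h3] at h2
    refine (ENNReal.toReal_mono (by simp [hD.2.ne]) h2).trans ?_
    rw [ENNReal.toReal_add hD.2.ne hD.2.ne]
  -- The error splits into one term with `A(·+σ) - A` and one with `D(·+h) - D`. Each is controlled
  -- by a translation modulus, small uniformly for `0 < σ ≤ h`.
  have hbound : ∀ h σ : ℝ, |(∫ r in s..t, inner ℝ (A (r + σ)) (D (r + h) + D r)) - 2 * I|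
      ≤ oA σ * (nD + nD) + nA * oD h := by
    intro h σ
    have mA := memLp_comp_add_right hA σ
    have mD := memLp_comp_add_right hD h
    have e : (∫ r in s..t, inner ℝ (A (r + σ)) (D (r + h) + D r)) - 2 * I
        = (∫ r in s..t, inner ℝ (A (r + σ) - A r) (D (r + h) + D r))
          + ∫ r in s..t, inner ℝ (A r) (D (r + h) - D r) := by
      rw [← intervalIntegral.integral_const_mul, ← intervalIntegral.integral_sub,
        ← intervalIntegral.integral_add]
      · refine intervalIntegral.integral_congr fun r _ => ?_
        simp only [inner_sub_left, inner_sub_right, inner_add_right]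
        ring
      · exact intervalIntegrable_inner (mA.sub hA) (mD.add hD) s t
      · exact intervalIntegrable_inner hA (mD.sub hD) s t
      · exact intervalIntegrable_inner mA (mD.add hD) s t
      · exact (intervalIntegrable_inner hA hD s t).const_mul 2
    rw [e]
    refine (abs_add_le _ _).trans (add_le_add ?_ ?_)
    · refine (abs_intervalIntegral_inner_le (mA.sub hA) (mD.add hD) hst).trans ?_
      exact mul_le_mul_of_nonneg_left (hsum h) ENNReal.toReal_nonneg
    · exact abs_intervalIntegral_inner_le hA (mD.sub hD) hst
  rw [Metric.tendsto_nhdsWithin_nhds]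
  intro e he
  have hlim : Tendsto (fun p : ℝ × ℝ => oA p.2 * (nD + nD) + nA * oD p.1) (𝓝 0 ×ˢ 𝓝 0)
      (𝓝 (0 * (nD + nD) + nA * 0)) :=
    ((((tendsto_eLpNorm_translate_sub hA).comp tendsto_snd).mul_const _)).add
      (((tendsto_eLpNorm_translate_sub hD).comp tendsto_fst).const_mul _)
  rw [zero_mul, mul_zero, add_zero, ← nhds_prod_eq] at hlim
  obtain ⟨η, hη, hlt⟩ := Metric.eventually_nhds_iff.1 (hlim.eventually (gt_mem_nhds (half_pos he)))
  refine ⟨η, hη, fun h hh hd => ?_⟩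
  have hh : 0 < h := hh
  rw [Real.dist_eq, sub_zero, abs_of_pos hh] at hd
  rw [Real.dist_eq]
  have hle : ∀ σ ∈ Set.uIoc 0 h,
      ‖(∫ r in s..t, inner ℝ (A (r + σ)) (D (r + h) + D r)) - 2 * I‖ ≤ e / 2 := by
    intro σ hσ
    rw [Set.uIoc_of_le hh.le] at hσ
    refine (hbound h σ).trans (le_of_lt (hlt (y := (h, σ)) ?_))
    rw [Prod.dist_eq]
    change max |h - 0| |σ - 0| < η
    rw [sub_zero, sub_zero, abs_of_pos hh, abs_of_pos hσ.1]
    exact max_lt hd (hσ.2.trans_lt hd)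
  have hint : IntervalIntegrable
      (fun σ => ∫ r in s..t, inner ℝ (A (r + σ)) (D (r + h) + D r)) volume 0 h := by
    have h1 := integrable_prod_inner_translate hAi ((hDi.comp_add_right h).add hDi)
    have h2 := h1.mono_measure (Measure.prod_mono (Measure.restrict_le_self (s := Set.Ioc s t))
      (le_refl volume))
    have h3 := h2.integral_prod_right.intervalIntegrable (a := 0) (b := h)
    simpa only [intervalIntegral.integral_of_le hst, Pi.add_apply] using h3
  have h1 := intervalIntegral.norm_integral_le_of_norm_le_const hle
  rw [intervalIntegral.integral_sub hint intervalIntegrable_const,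
    intervalIntegral.integral_const, sub_zero, smul_eq_mul, Real.norm_eq_abs,
    abs_of_pos hh] at h1
  have h2 : h⁻¹ * (∫ σ in (0 : ℝ)..h, ∫ r in s..t, inner ℝ (A (r + σ)) (D (r + h) + D r))
      - 2 * I = h⁻¹ * ((∫ σ in (0 : ℝ)..h,
        ∫ r in s..t, inner ℝ (A (r + σ)) (D (r + h) + D r)) - h * (2 * I)) := by
    field_simp
  rw [h2, abs_mul, abs_of_pos (inv_pos.2 hh), inv_mul_lt_iff₀ hh]
  nlinarith

/-- The energy identity at almost all times: if `w` is a primitive of a functional given by `A`,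
tested with the values of `w` itself through `D`, then `‖w‖²` is a primitive of `-2 ⟨A, D⟩`. -/
theorem exists_energy_identity {a b : ℝ} {w : ℝ → H} {A D : ℝ → X} {E : Set ℝ}
    [CompleteSpace X]
    (hA : MemLp A 2 volume) (hD : MemLp D 2 volume) (hAi : Integrable A volume)
    (hDi : Integrable D volume) (hw : Integrable (fun t => ‖w t‖ ^ 2) volume)
    (hE : ∀ᵐ t, t ∈ Set.Ioo a b → t ∈ E)
    (hid : ∀ s ∈ E, ∀ t ∈ E, ∀ r ∈ E,
      (inner ℝ (w t - w s) (w r) : ℝ) = -inner ℝ (∫ ρ in s..t, A ρ) (D r)) :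
    ∃ E' : Set ℝ, E' ⊆ E ∧ E' ⊆ Set.Ioo a b ∧ (∀ᵐ t, t ∈ Set.Ioo a b → t ∈ E') ∧
      ∀ s ∈ E', ∀ t ∈ E', ‖w t‖ ^ 2 - ‖w s‖ ^ 2 = -(2 * ∫ r in s..t, inner ℝ (A r) (D r)) := by
  set N : ℝ → ℝ := fun t => ‖w t‖ ^ 2 with hN
  -- Only times at which the primitive of `‖w‖²` is differentiable are kept, so that the forward
  -- averages of `‖w‖²` converge to its value there.
  refine ⟨E ∩ Set.Ioo a b ∩ {t | ∀ c, HasDerivAt (fun x => ∫ r in c..x, N r) (N t) t},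
    fun t ht => ht.1.1, fun t ht => ht.1.2, ?_, ?_⟩
  · filter_upwards [hE, LocallyIntegrable.ae_hasDerivAt_integral hw.locallyIntegrable]
      with t h1 h2 h3 using ⟨⟨h1 h3, h3⟩, h2⟩
  intro s hs t ht
  wlog hst : s ≤ t generalizing s t
  · have := this t ht s hs (le_of_not_ge hst)
    rw [intervalIntegral.integral_symm]; linarith
  have hNi : ∀ x y : ℝ, IntervalIntegrable N volume x y := fun _ _ => hw.intervalIntegrable
  have hleb : ∀ x, HasDerivAt (fun y => ∫ r in x..y, N r) (N x) x →
      Tendsto (fun h : ℝ => h⁻¹ * ∫ r in x..x + h, N r) (𝓝[>] 0) (𝓝 (N x)) := by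
    intro x hx
    have := hx.tendsto_slope_zero_right
    simpa using this
  have hlim1 := (hleb t (ht.2 t)).sub (hleb s (hs.2 s))
  have hlim2 := (tendsto_average_integral_inner hA hD hAi hDi hst).neg
  -- The increment formula over `[r, r+h]` is tested at both times `r` and `r + h`; the sum is the
  -- increment of `‖w‖²`. Integrated over `r`, it leaves only the forward averages at `t` and at
  -- `s`.
  have hev : (fun h : ℝ => -(h⁻¹ * ∫ σ in (0 : ℝ)..h,
        ∫ r in s..t, inner ℝ (A (r + σ)) (D (r + h) + D r))) =ᶠ[𝓝[>] 0]
      fun h => h⁻¹ * (∫ r in t..t + h, N r) - h⁻¹ * ∫ r in s..s + h, N r := by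
    have hb : (0 : ℝ) < b - t := sub_pos.2 ht.1.2.2
    filter_upwards [Ioo_mem_nhdsGT hb] with h hh
    have h0 : 0 < h := hh.1
    have e1 : (∫ r in t..t + h, N r) - ∫ r in s..s + h, N r
        = ∫ r in s..t, (N (r + h) - N r) := by
      rw [intervalIntegral.integral_sub ((hw.comp_add_right h).intervalIntegrable) (hNi _ _),
        intervalIntegral.integral_comp_add_right,
        intervalIntegral.integral_interval_sub_interval_comm' (hNi _ _) (hNi _ _) (hNi _ _)]
    have e2 : ∫ r in s..t, (N (r + h) - N r)
        = ∫ r in s..t, -∫ σ in (0 : ℝ)..h, (inner ℝ (A (r + σ)) (D (r + h) + D r) : ℝ) := by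
      refine intervalIntegral.integral_congr_ae ?_
      have hE' := (measurePreserving_add_right (volume : Measure ℝ) h).quasiMeasurePreserving.ae hE
      filter_upwards [hE, hE'] with r hr hrh hm
      rw [Set.uIoc_of_le hst] at hm
      have r1 : r ∈ E := hr ⟨hs.1.2.1.trans hm.1, hm.2.trans_lt ht.1.2.2⟩
      have r2 : r + h ∈ E := hrh ⟨by linarith [hs.1.2.1, hm.1], by linarith [hm.2, hh.2]⟩
      have i1 := hid r r1 (r + h) r2 (r + h) r2
      have i2 := hid r r1 (r + h) r2 r r1
      have i3 : N (r + h) - N r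
          = inner ℝ (w (r + h) - w r) (w (r + h)) + inner ℝ (w (r + h) - w r) (w r) := by
        simp only [hN, inner_sub_left, real_inner_self_eq_norm_sq, real_inner_comm (w r) (w (r + h))]
        ring
      have i4 : ∫ σ in (0 : ℝ)..h, (inner ℝ (A (r + σ)) (D (r + h) + D r) : ℝ)
          = inner ℝ (∫ ρ in r..r + h, A ρ) (D (r + h) + D r) := by
        have hsh : ∫ ρ in r..r + h, A ρ = ∫ σ in (0 : ℝ)..h, A (r + σ) := by
          rw [intervalIntegral.integral_comp_add_left, add_zero]
        rw [hsh, real_inner_comm, intervalIntegral.integral_of_le h0.le,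
          intervalIntegral.integral_of_le h0.le, ← integral_inner]
        · simp only [real_inner_comm]
        · exact (hAi.comp_add_left r).integrableOn
      rw [i3, i1, i2, i4, inner_add_right]; ring
    have e3 : ∫ r in s..t, ∫ σ in (0 : ℝ)..h, (inner ℝ (A (r + σ)) (D (r + h) + D r) : ℝ)
        = ∫ σ in (0 : ℝ)..h, ∫ r in s..t, inner ℝ (A (r + σ)) (D (r + h) + D r) := by
      simp only [intervalIntegral.integral_of_le hst, intervalIntegral.integral_of_le h0.le]
      have h1 := integrable_prod_inner_translate hAi ((hDi.comp_add_right h).add hDi)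
      exact integral_integral_swap (h1.mono_measure
        (Measure.prod_mono Measure.restrict_le_self Measure.restrict_le_self))
    rw [← mul_sub, e1, e2, intervalIntegral.integral_neg, e3]; ring
  exact tendsto_nhds_unique hlim1 (hlim2.congr' hev)

end EnergyIdentity

/-! ### Continuous representative and the end points -/

section ContinuousRepresentative

variable {H X : Type*} [NormedAddCommGroup H] [InnerProductSpace ℝ H]
  [NormedAddCommGroup X] [InnerProductSpace ℝ X]

/-- An energy identity and a tested increment formula control the oscillation. -/
theorem norm_sub_sq_le_integral {w : ℝ → H} {A D : ℝ → X} {E : Set ℝ} {a b : ℝ}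
    (hA : MemLp A 2 volume) (hD : MemLp D 2 volume) (hAi : Integrable A volume)
    (hEab : E ⊆ Set.Ioo a b) (hE : ∀ᵐ t, t ∈ Set.Ioo a b → t ∈ E)
    (hid : ∀ s ∈ E, ∀ t ∈ E, ∀ r ∈ E,
      (inner ℝ (w t - w s) (w r) : ℝ) = -inner ℝ (∫ ρ in s..t, A ρ) (D r))
    (hen : ∀ s ∈ E, ∀ t ∈ E,
      ‖w t‖ ^ 2 - ‖w s‖ ^ 2 = -(2 * ∫ r in s..t, inner ℝ (A r) (D r)))
    {t t' : ℝ} (ht : t ∈ E) (ht' : t' ∈ E) (htt : t < t') :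
    ‖w t' - w t‖ ^ 2 ≤ 8 * ∫ r in t..t', (‖A r‖ ^ 2 + ‖D r‖ ^ 2) := by
  have hA2 : Integrable (fun r => ‖A r‖ ^ 2) volume := (memLp_two_iff_integrable_sq_norm hA.1).1 hA
  have hD2 : Integrable (fun r => ‖D r‖ ^ 2) volume := (memLp_two_iff_integrable_sq_norm hD.1).1 hD
  set S := Set.Ioc t t' with hS
  rw [intervalIntegral.integral_of_le htt.le,
    integral_add hA2.integrableOn hD2.integrableOn]
  have hSvol : (volume.restrict S).real Set.univ = t' - t := by
    simp [hS, Real.volume_real_Ioc_of_le htt.le]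
  -- The intermediate time `x` is one where `‖D‖²` does not exceed its mean over `(t, t']`. This
  -- makes the pointwise factor `D x` below controllable by an integral.
  obtain ⟨x, hxE, hxD⟩ : ∃ x, (x ∈ S ∧ x ∈ E) ∧
      (t' - t) * ‖D x‖ ^ 2 ≤ ∫ r in S, ‖D r‖ ^ 2 := by
    have hne : volume.restrict S ≠ 0 := by
      rw [Ne, Measure.restrict_eq_zero, hS, Real.volume_Ioc]
      simpa using htt
    have hnull : (volume.restrict S) {x | ¬(x ∈ S ∧ x ∈ E)} = 0 := by
      have : ∀ᵐ x ∂volume.restrict S, x ∈ S ∧ x ∈ E := by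
        rw [ae_restrict_iff' measurableSet_Ioc]
        filter_upwards [hE] with x hx hxS
        exact ⟨hxS, hx ⟨(hEab ht).1.trans hxS.1, hxS.2.trans_lt (hEab ht').2⟩⟩
      exact this
    obtain ⟨x, hx, hle⟩ := exists_notMem_null_le_average hne hD2.integrableOn hnull
    refine ⟨x, not_not.1 hx, ?_⟩
    rw [average_eq, hSvol, smul_eq_mul, le_inv_mul_iff₀ (sub_pos.2 htt)] at hle
    exact hle
  have hAD : Integrable (fun r => ‖A r‖ ^ 2 + ‖D r‖ ^ 2) (volume.restrict S) :=
    (hA2.add hD2).integrableOn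
  -- Expand `‖w y - w x‖² = ‖w y‖² - ‖w x‖² - 2⟨w y - w x, w x⟩`: the energy identity treats the
  -- difference of squares and the increment formula, tested at time `x`, the inner product.
  have key : ∀ y ∈ E, Set.uIoc x y ⊆ S →
      ‖w y - w x‖ ^ 2 ≤ 2 * ((∫ r in S, ‖A r‖ ^ 2) + ∫ r in S, ‖D r‖ ^ 2) := by
    intro y hy hsub
    have h1 := hen x hxE.2 y hy
    have h2 := hid x hxE.2 y hy x hxE.2
    have h3 : ‖w y - w x‖ ^ 2 = ‖w y‖ ^ 2 - ‖w x‖ ^ 2 - 2 * inner ℝ (w y - w x) (w x) := by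
      rw [norm_sub_sq_real, inner_sub_left, real_inner_self_eq_norm_sq]; ring
    have b1 : |∫ r in x..y, inner ℝ (A r) (D r)|
        ≤ 1 / 2 * ((∫ r in S, ‖A r‖ ^ 2) + ∫ r in S, ‖D r‖ ^ 2) := by
      rw [← integral_add hA2.integrableOn hD2.integrableOn, ← integral_const_mul,
        ← Real.norm_eq_abs]
      refine (intervalIntegral.norm_integral_le_integral_norm_uIoc).trans ?_
      refine (setIntegral_mono_set (integrable_inner hA hD).norm.integrableOn
        (Eventually.of_forall fun _ => norm_nonneg _) hsub.eventuallyLE).trans ?_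
      refine integral_mono (integrable_inner hA hD).norm.integrableOn (hAD.const_mul _)
        fun r => ?_
      simp only
      nlinarith [norm_inner_le_norm (𝕜 := ℝ) (A r) (D r), sq_nonneg (‖A r‖ - ‖D r‖)]
    have b2 : |inner ℝ (∫ ρ in x..y, A ρ) (D x)|
        ≤ 1 / 2 * ((∫ r in S, ‖A r‖ ^ 2) + ∫ r in S, ‖D r‖ ^ 2) := by
      refine (abs_real_inner_le_norm _ _).trans ?_
      have c1 : ‖∫ ρ in x..y, A ρ‖ ≤ ∫ r in S, ‖A r‖ :=
        (intervalIntegral.norm_integral_le_integral_norm_uIoc).trans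
          (setIntegral_mono_set hAi.norm.integrableOn
            (Eventually.of_forall fun _ => norm_nonneg _) hsub.eventuallyLE)
      have c2 : (∫ r in S, ‖A r‖) * ‖D x‖ ≤ ∫ r in S, (1 / 2 * (‖A r‖ ^ 2 + ‖D x‖ ^ 2)) := by
        rw [← integral_mul_const]
        refine integral_mono (hAi.norm.integrableOn.mul_const _)
          ((hA2.integrableOn.add (integrable_const _)).const_mul _) fun r => ?_
        simp only
        nlinarith [sq_nonneg (‖A r‖ - ‖D x‖)]
      rw [integral_const_mul, integral_add hA2.integrableOn (integrable_const _),
        integral_const, hSvol, smul_eq_mul] at c2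
      have := mul_le_mul_of_nonneg_right c1 (norm_nonneg (D x))
      linarith
    have := abs_le.1 b1
    have := abs_le.1 b2
    rw [h3, h1, h2]
    linarith
  have k1 := key t ht (by
    rw [Set.uIoc_of_ge hxE.1.1.le]; exact Set.Ioc_subset_Ioc_right hxE.1.2)
  have k2 := key t' ht' (by
    rw [Set.uIoc_of_le hxE.1.2]; exact Set.Ioc_subset_Ioc_left hxE.1.1.le)
  have k3 : ‖w t' - w t‖ ≤ ‖w t' - w x‖ + ‖w t - w x‖ := by
    rw [norm_sub_rev (w t) (w x)]
    exact norm_sub_le_norm_sub_add_norm_sub _ _ _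
  have k4 := pow_le_pow_left₀ (norm_nonneg _) k3 2
  nlinarith [sq_nonneg (‖w t' - w x‖ - ‖w t - w x‖)]

theorem subset_closure_of_ae_mem {a b : ℝ} (hab : a < b) {E : Set ℝ}
    (hE : ∀ᵐ t, t ∈ Set.Ioo a b → t ∈ E) : Set.Icc a b ⊆ closure E := by
  rw [← closure_Ioo hab.ne]
  refine closure_minimal (fun x hx => ?_) isClosed_closure
  rw [mem_closure_iff]
  intro o ho hxo
  by_contra hemp
  have hpos : volume (o ∩ Set.Ioo a b) ≠ 0 :=
    ((ho.inter isOpen_Ioo).measure_pos volume ⟨x, hxo, hx⟩).ne'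
  refine hpos (measure_mono_null (fun y hy => ?_) (ae_iff.1 hE))
  simp only [Set.mem_ofPred_eq, not_forall]
  exact ⟨hy.2, fun hyE => hemp ⟨y, hy.1, hyE⟩⟩

/-- **Lions–Magenes lemma** in abstract form: a weak primitive admits a continuous representative,
which satisfies the energy identity up to the end points. -/
theorem exists_continuousOn_energy_identity [CompleteSpace H] [CompleteSpace X]
    {a b : ℝ} (hab : a < b) {w : ℝ → H} {A D : ℝ → X} {E : Set ℝ}
    (hA : MemLp A 2 volume) (hD : MemLp D 2 volume) (hAi : Integrable A volume)
    (hDi : Integrable D volume) (hw : Integrable (fun t => ‖w t‖ ^ 2) volume)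
    (hE : ∀ᵐ t, t ∈ Set.Ioo a b → t ∈ E)
    (hid : ∀ s ∈ E, ∀ t ∈ E, ∀ r ∈ E,
      (inner ℝ (w t - w s) (w r) : ℝ) = -inner ℝ (∫ ρ in s..t, A ρ) (D r)) :
    ∃ W : ℝ → H, ContinuousOn W (Set.Icc a b) ∧ (∀ᵐ t, t ∈ Set.Ioo a b → W t = w t) ∧
      ‖W b‖ ^ 2 - ‖W a‖ ^ 2 = -(2 * ∫ r in a..b, inner ℝ (A r) (D r)) := by
  obtain ⟨E', hE'E, hE'ab, hE', hen⟩ := exists_energy_identity hA hD hAi hDi hw hE hid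
  have hid' : ∀ s ∈ E', ∀ t ∈ E', ∀ r ∈ E',
      (inner ℝ (w t - w s) (w r) : ℝ) = -inner ℝ (∫ ρ in s..t, A ρ) (D r) :=
    fun s hs t ht r hr => hid s (hE'E hs) t (hE'E ht) r (hE'E hr)
  have hcl := subset_closure_of_ae_mem hab hE'
  set P : ℝ → ℝ := fun r => ‖A r‖ ^ 2 + ‖D r‖ ^ 2 with hP
  have hPi : Integrable P volume := ((memLp_two_iff_integrable_sq_norm hA.1).1 hA).add
    ((memLp_two_iff_integrable_sq_norm hD.1).1 hD)
  set Γ : ℝ → ℝ := fun t => ∫ r in a..t, P r with hΓ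
  have hΓc : Continuous Γ := intervalIntegral.continuous_primitive
    (fun _ _ => hPi.intervalIntegrable) a
  -- Since `Γ` is continuous on the whole line, `w` is Cauchy along `E'` at every point of `[a, b]`,
  -- end points included, and so extends continuously.
  have hosc : ∀ t ∈ E', ∀ t' ∈ E', dist (w t) (w t') ^ 2 ≤ 8 * dist (Γ t) (Γ t') := by
    have aux : ∀ t ∈ E', ∀ t' ∈ E', t < t' → dist (w t) (w t') ^ 2 ≤ 8 * dist (Γ t) (Γ t') := by
      intro t ht t' ht' h
      have h1 := norm_sub_sq_le_integral hA hD hAi hE'ab hE' hid' hen ht ht' h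
      rw [dist_comm, dist_eq_norm, dist_comm, Real.dist_eq, hΓ]
      simp only
      rw [intervalIntegral.integral_interval_sub_left hPi.intervalIntegrable
        hPi.intervalIntegrable]
      exact h1.trans (mul_le_mul_of_nonneg_left (le_abs_self _) (by norm_num))
    intro t ht t' ht'
    rcases lt_trichotomy t t' with h | h | h
    · exact aux t ht t' ht' h
    · subst h; simp
    · rw [dist_comm, dist_comm (Γ t)]; exact aux t' ht' t ht h
  have hlim : ∀ x ∈ Set.Icc a b, ∃ y, Tendsto w (𝓝[E'] x) (𝓝 y) := by
    intro x hx
    have : (𝓝[E'] x).NeBot := mem_closure_iff_nhdsWithin_neBot.1 (hcl hx)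
    rw [← cauchy_map_iff_exists_tendsto, Metric.cauchy_iff]
    refine ⟨inferInstance, fun e he => ?_⟩
    have hη : 0 < e ^ 2 / 32 := by positivity
    have hnb : {t | dist (Γ t) (Γ x) < e ^ 2 / 32} ∩ E' ∈ 𝓝[E'] x :=
      inter_mem (mem_nhdsWithin_of_mem_nhds (hΓc.continuousAt (Metric.ball_mem_nhds _ hη)))
        self_mem_nhdsWithin
    refine ⟨w '' _, image_mem_map hnb, ?_⟩
    rintro _ ⟨t, ht, rfl⟩ _ ⟨t', ht', rfl⟩
    have h1 := hosc t ht.2 t' ht'.2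
    have h2 := dist_triangle_right (Γ t) (Γ t') (Γ x)
    have h3 : dist (Γ t) (Γ x) < e ^ 2 / 32 := ht.1
    have h4 : dist (Γ t') (Γ x) < e ^ 2 / 32 := ht'.1
    exact lt_of_pow_lt_pow_left₀ 2 he.le (by linarith)
  have hwc : ContinuousOn w E' := by
    intro x hx
    obtain ⟨y, hy⟩ := hlim x (Set.Ioo_subset_Icc_self (hE'ab hx))
    have : w x = y := by
      refine tendsto_nhds_unique (f := w) (l := pure x) (tendsto_pure_nhds w x)
        (hy.mono_left (pure_le_nhdsWithin hx))
    rw [ContinuousWithinAt, this]; exact hy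
  have hWc := continuousOn_extendFrom hcl hlim
  have hWe := extendFrom_extends hwc
  set W := extendFrom E' w
  refine ⟨W, hWc, hE'.mono fun t ht h => hWe t (ht h), ?_⟩
  have hADi := integrable_inner hA hD
  -- The energy identity says that `Q` is constant on the dense set `E'`; by continuity it is
  -- constant on `[a, b]`.
  set Q : ℝ → ℝ := fun t => ‖W t‖ ^ 2 + 2 * ∫ r in a..t, inner ℝ (A r) (D r) with hQ
  have hQc : ContinuousOn Q (Set.Icc a b) := (hWc.norm.pow 2).add
    ((intervalIntegral.continuous_primitive (fun _ _ => hADi.intervalIntegrable) a).continuousOn.const_smul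
      (2 : ℝ))
  have hQconst : ∀ t ∈ E', ∀ t' ∈ E', Q t = Q t' := by
    intro t ht t' ht'
    have h1 := hen t ht t' ht'
    rw [← intervalIntegral.integral_interval_sub_left (a := a) hADi.intervalIntegrable
      hADi.intervalIntegrable] at h1
    simp only [hQ, hWe t ht, hWe t' ht']
    linarith
  obtain ⟨t₀, ht₀⟩ : E'.Nonempty :=
    closure_nonempty_iff.1 ⟨a, hcl (Set.left_mem_Icc.2 hab.le)⟩
  have hall : ∀ x ∈ Set.Icc a b, Q x = Q t₀ := by
    intro x hx
    have : (𝓝[E'] x).NeBot := mem_closure_iff_nhdsWithin_neBot.1 (hcl hx)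
    refine tendsto_nhds_unique ((hQc x hx).mono_left (nhdsWithin_mono x
      (hE'ab.trans Set.Ioo_subset_Icc_self))) (tendsto_const_nhds.congr' ?_)
    filter_upwards [self_mem_nhdsWithin] with t ht using hQconst t₀ ht₀ t ht
  have q1 := hall a (Set.left_mem_Icc.2 hab.le)
  have q2 := hall b (Set.right_mem_Icc.2 hab.le)
  rw [← q1] at q2
  simp only [hQ, intervalIntegral.integral_same] at q2
  linarith

end ContinuousRepresentative

/-! ### Space-time `L²` functions as curves in `L²` -/

section Curry

theorem ae_ae_of_ae_prod_right {α β : Type*} [MeasurableSpace α] [MeasurableSpace β]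
    {μ : Measure α} {ν : Measure β} [SFinite μ] [SFinite ν] {p : α × β → Prop}
    (h : ∀ᵐ z ∂μ.prod ν, p z) : ∀ᵐ y ∂ν, ∀ᵐ x ∂μ, p (x, y) :=
  Measure.ae_ae_of_ae_prod (μ := ν) (ν := μ) (p := fun z => p z.swap)
    (Measure.measurePreserving_swap.quasiMeasurePreserving.ae h)

/-- By second countability every open set is a countable union of balls, so distances to fixed
points detect measurability. This serves for maps into `L²`, where such distances are integrals. -/
theorem measurable_of_measurable_edist {β Y : Type*} [MeasurableSpace β] [PseudoEMetricSpace Y]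
    [SecondCountableTopology Y] [MeasurableSpace Y] [BorelSpace Y] {f : β → Y}
    (h : ∀ c, Measurable fun t => edist (f t) c) : Measurable f := by
  refine measurable_of_isOpen fun U hU => ?_
  choose r hr using fun x : U => EMetric.isOpen_iff.1 hU x x.2
  obtain ⟨T, -, hTc, hTU⟩ := TopologicalSpace.isOpen_biUnion_countable (Set.univ : Set U)
    (fun x => Metric.eball (x : Y) (r x)) (fun _ _ => Metric.isOpen_eball)
  have hU' : U = ⋃ x ∈ T, Metric.eball (x : Y) (r x) := by
    rw [hTU]
    refine Set.Subset.antisymm (fun x hx => ?_) (Set.iUnion₂_subset fun x _ => (hr x).2)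
    exact Set.mem_iUnion₂.2 ⟨⟨x, hx⟩, trivial, Metric.mem_eball_self (hr ⟨x, hx⟩).1⟩
  rw [hU', Set.preimage_iUnion₂]
  refine MeasurableSet.biUnion hTc fun x _ => ?_
  exact measurableSet_lt (h x) measurable_const

variable {α F : Type*} [MeasurableSpace α] [NormedAddCommGroup F] [InnerProductSpace ℝ F]

theorem L2_inner_eq_integral {μ : Measure α} {f g : Lp F 2 μ} {f' g' : α → F}
    (hf : f =ᵐ[μ] f') (hg : g =ᵐ[μ] g') :
    (inner ℝ f g : ℝ) = ∫ x, inner ℝ (f' x) (g' x) ∂μ := by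
  rw [L2.inner_def]
  refine integral_congr_ae ?_
  filter_upwards [hf, hg] with x h1 h2
  rw [h1, h2]

theorem L2_norm_sq_eq_integral {μ : Measure α} {f : Lp F 2 μ} {f' : α → F}
    (hf : f =ᵐ[μ] f') : ‖f‖ ^ 2 = ∫ x, ‖f' x‖ ^ 2 ∂μ := by
  rw [← real_inner_self_eq_norm_sq, L2_inner_eq_integral hf hf]
  simp only [real_inner_self_eq_norm_sq]

/-- A square integrable function on a product is a square integrable function with values
in `L²`. -/
theorem exists_curry_memLp {β : Type*} [MeasurableSpace β] {μ : Measure α} {ν : Measure β}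
    [SFinite μ] [SFinite ν] [IsSeparable μ] [TopologicalSpace.SeparableSpace F]
    {f : α × β → F} (hf : MemLp f 2 (μ.prod ν)) :
    ∃ Φ : β → Lp F 2 μ, MemLp Φ 2 ν ∧ ∀ᵐ t ∂ν, Φ t =ᵐ[μ] fun x => f (x, t) := by
  classical
  have : Fact ((2 : ENNReal) ≠ ⊤) := ⟨by norm_num⟩
  borelize F ↥(Lp F 2 μ)
  have : SecondCountableTopology F := UniformSpace.secondCountable_of_separable F
  -- A strongly measurable representative has measurable slices at every `t`, not only at almost
  -- every one.
  set g := hf.1.mk f with hg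
  have hgm : StronglyMeasurable g := hf.1.stronglyMeasurable_mk
  have hfg : f =ᵐ[μ.prod ν] g := hf.1.ae_eq_mk
  have hg2 : Integrable (fun z => ‖g z‖ ^ 2) (μ.prod ν) :=
    (memLp_two_iff_integrable_sq_norm hgm.aestronglyMeasurable).1 (hf.ae_eq hfg)
  have hslice : ∀ t, StronglyMeasurable fun x => g (x, t) := fun t =>
    hgm.comp_measurable measurable_prodMk_right
  -- The default value 0 is taken where the slice is not square integrable: a measurable set of
  -- times, null by Fubini.
  set Φ : β → Lp F 2 μ := fun t =>
    if h : MemLp (fun x => g (x, t)) 2 μ then h.toLp _ else 0 with hΦ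
  have hae : ∀ᵐ t ∂ν, MemLp (fun x => g (x, t)) 2 μ := by
    filter_upwards [hg2.prod_left_ae] with t ht
    exact (memLp_two_iff_integrable_sq_norm (hslice t).aestronglyMeasurable).2 ht
  have hΦg : ∀ᵐ t ∂ν, Φ t =ᵐ[μ] fun x => g (x, t) := by
    filter_upwards [hae] with t ht
    simp only [hΦ, ht, dif_pos]
    exact ht.coeFn_toLp
  have hmeas_eLp : ∀ G : α × β → F, StronglyMeasurable G →
      Measurable fun t => eLpNorm (fun x => G (x, t)) 2 μ := by
    intro G hG
    simp only [eLpNorm_eq_lintegral_rpow_enorm_toReal (p := 2) (by norm_num) (by norm_num)]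
    exact ((hG.enorm.pow_const _).lintegral_prod_left').pow_const _
  have hmeas : Measurable Φ := by
    refine measurable_of_measurable_edist fun c => ?_
    have hS : MeasurableSet {t | MemLp (fun x => g (x, t)) 2 μ} := by
      have : {t | MemLp (fun x => g (x, t)) 2 μ} = {t | eLpNorm (fun x => g (x, t)) 2 μ < ⊤} := by
        ext t; exact ⟨fun h => h.2, fun h => ⟨(hslice t).aestronglyMeasurable, h⟩⟩
      rw [this]
      exact measurableSet_lt (hmeas_eLp g hgm) measurable_const
    have hc : StronglyMeasurable (fun z : α × β => (c : α → F) z.1) :=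
      (Lp.stronglyMeasurable c).comp_measurable measurable_fst
    have e : (fun t => edist (Φ t) c) = {t | MemLp (fun x => g (x, t)) 2 μ}.piecewise
        (fun t => eLpNorm (fun x => g (x, t) - c x) 2 μ) (fun _ => edist 0 c) := by
      ext t
      by_cases h : MemLp (fun x => g (x, t)) 2 μ
      · rw [Set.piecewise_eq_of_mem _ _ _ (by exact h)]
        simp only [hΦ, h, dif_pos, Lp.edist_def]
        refine eLpNorm_congr_ae ?_
        filter_upwards [h.coeFn_toLp] with x hx
        simp [hx]
      · rw [Set.piecewise_eq_of_notMem _ _ _ (by exact h)]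
        simp [hΦ, h]
    rw [e]
    exact (hmeas_eLp _ (hgm.sub hc)).piecewise hS measurable_const
  refine ⟨Φ, ?_, ?_⟩
  · have hsm : AEStronglyMeasurable Φ ν := hmeas.stronglyMeasurable.aestronglyMeasurable
    rw [memLp_two_iff_integrable_sq_norm hsm]
    refine hg2.integral_prod_right.congr ?_
    filter_upwards [hΦg] with t ht
    exact (L2_norm_sq_eq_integral ht).symm
  · filter_upwards [hΦg, ae_ae_of_ae_prod_right hfg] with t h1 h2
    exact h1.trans (h2.mono fun x hx => hx.symm)

/-- The version of `exists_curry_memLp` for functions on a bounded time interval, with the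
vector-valued function extended by zero. -/
theorem exists_curry_memLp_Ioo {μ : Measure α} [SFinite μ] [IsSeparable μ]
    [TopologicalSpace.SeparableSpace F] {a b : ℝ} {f : α × ℝ → F}
    (hf : MemLp f 2 (μ.prod (volume.restrict (Set.Ioo a b)))) :
    ∃ Φ : ℝ → Lp F 2 μ, MemLp Φ 2 volume ∧ Integrable Φ volume ∧
      ∀ᵐ t ∂volume.restrict (Set.Ioo a b), Φ t =ᵐ[μ] fun x => f (x, t) := by
  obtain ⟨Φ, h1, h2⟩ := exists_curry_memLp hf
  -- The extension to the whole line is what makes time translations available in the energy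
  -- argument.
  refine ⟨(Set.Ioo a b).indicator Φ, (memLp_indicator_iff_restrict measurableSet_Ioo).2 h1,
    (integrable_indicator_iff measurableSet_Ioo).2 (h1.integrable (by norm_num)), ?_⟩
  rw [ae_restrict_iff' measurableSet_Ioo] at h2 ⊢
  filter_upwards [h2] with t ht hmem
  rw [Set.indicator_of_mem hmem]
  exact ht hmem

end Curry

/-! ### From the weak equation to the energy identity -/

section WeakEquation

variable {n : ℕ}

theorem continuous_gradient {E : Type*} [NormedAddCommGroup E] [InnerProductSpace ℝ E]
    [CompleteSpace E] {ψ : E → ℝ} (h : ContDiff ℝ 1 ψ) : Continuous (gradient ψ) :=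
  (InnerProductSpace.toDual ℝ E).symm.continuous.comp (h.continuous_fderiv (by simp))

theorem HasCompactSupport.gradient {E : Type*} [NormedAddCommGroup E] [InnerProductSpace ℝ E]
    [CompleteSpace E] {ψ : E → ℝ} (h : HasCompactSupport ψ) : HasCompactSupport (gradient ψ) :=
  (h.fderiv ℝ).comp_left (g := (InnerProductSpace.toDual ℝ E).symm) (map_zero _)

theorem gradient_mul_const {E : Type*} [NormedAddCommGroup E] [InnerProductSpace ℝ E]
    [CompleteSpace E] {ψ : E → ℝ} {x : E} (h : DifferentiableAt ℝ ψ x) (c : ℝ) :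
    gradient (fun y => ψ y * c) x = c • gradient ψ x := by
  refine HasGradientAt.gradient ?_
  rw [hasGradientAt_iff_hasFDerivAt, map_smul]
  exact h.hasGradientAt.hasFDerivAt.mul_const c

theorem IsTestFunction.memLp {E : Type*} [NormedAddCommGroup E] [NormedSpace ℝ E]
    [MeasurableSpace E] [OpensMeasurableSpace E] {U : Set E} {ψ : E → ℝ} (h : IsTestFunction U ψ)
    (μ : Measure E) [IsFiniteMeasureOnCompacts μ] : MemLp ψ 2 μ :=
  h.1.continuous.memLp_of_hasCompactSupport h.2.1

theorem IsTestFunction.memLp_gradient {U : Set (EuclideanSpace ℝ (Fin n))}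
    {ψ : EuclideanSpace ℝ (Fin n) → ℝ} (h : IsTestFunction U ψ)
    (μ : Measure (EuclideanSpace ℝ (Fin n))) [IsFiniteMeasureOnCompacts μ] :
    MemLp (gradient ψ) 2 μ :=
  (continuous_gradient (h.1.of_le (by simp))).memLp_of_hasCompactSupport h.2.1.gradient

theorem IsTestFunction.prod_mul {E : Type*} [NormedAddCommGroup E] [NormedSpace ℝ E]
    {U : Set E} {V : Set ℝ} {ψ : E → ℝ} {χ : ℝ → ℝ} (hψ : IsTestFunction U ψ)
    (hχ : IsTestFunction V χ) : IsTestFunction (U ×ˢ V) fun z : E × ℝ => ψ z.1 * χ z.2 := by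
  have hts : tsupport (fun z : E × ℝ => ψ z.1 * χ z.2) ⊆ tsupport ψ ×ˢ tsupport χ := by
    refine closure_minimal (fun z hz => ?_) ((isClosed_tsupport ψ).prod (isClosed_tsupport χ))
    exact ⟨subset_tsupport ψ (left_ne_zero_of_mul hz), subset_tsupport χ (right_ne_zero_of_mul hz)⟩
  refine ⟨(hψ.1.comp contDiff_fst).mul (hχ.1.comp contDiff_snd), ?_,
    hts.trans (Set.prod_mono hψ.2.2 hχ.2.2)⟩
  exact HasCompactSupport.of_support_subset_isCompact
    (hψ.2.1.isCompact.prod hχ.2.1.isCompact) ((subset_tsupport _).trans hts)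

/-- The pairs `(ψ, Dψ)` in `L² × L²` with `ψ` a test function. -/
def testPairs (U : Set (EuclideanSpace ℝ (Fin n))) :
    Set (Lp ℝ 2 (volume.restrict U) × Lp (EuclideanSpace ℝ (Fin n)) 2 (volume.restrict U)) :=
  {p | ∃ ψ : EuclideanSpace ℝ (Fin n) → ℝ, IsTestFunction U ψ ∧
    p.1 =ᵐ[volume.restrict U] ψ ∧ p.2 =ᵐ[volume.restrict U] gradient ψ}

/-- Function and gradient are approximated jointly, because the increment identity involves both. -/
theorem IsW12Zero.mem_closure_testPairs {U : Set (EuclideanSpace ℝ (Fin n))}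
    {f : EuclideanSpace ℝ (Fin n) → ℝ}
    {G : EuclideanSpace ℝ (Fin n) → EuclideanSpace ℝ (Fin n)} (h : IsW12Zero U f G)
    {f' : Lp ℝ 2 (volume.restrict U)} {G' : Lp (EuclideanSpace ℝ (Fin n)) 2 (volume.restrict U)}
    (hf : f' =ᵐ[volume.restrict U] f) (hG : G' =ᵐ[volume.restrict U] G) :
    (f', G') ∈ closure (testPairs U) := by
  obtain ⟨hf2, hG2, φ, hφ, hl1, hl2⟩ := h
  have e1 : f' = hf2.toLp f := Lp.ext (hf.trans hf2.coeFn_toLp.symm)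
  have e2 : G' = hG2.toLp G := Lp.ext (hG.trans hG2.coeFn_toLp.symm)
  have t1 := (Lp.tendsto_Lp_iff_tendsto_eLpNorm'' φ (fun k => (hφ k).memLp _) f hf2).2 hl1
  have t2 := (Lp.tendsto_Lp_iff_tendsto_eLpNorm'' (fun k => gradient (φ k))
    (fun k => (hφ k).memLp_gradient _) G hG2).2 hl2
  rw [e1, e2]
  refine mem_closure_of_tendsto (t1.prodMk_nhds t2) (Eventually.of_forall fun k => ?_)
  exact ⟨φ k, hφ k, ((hφ k).memLp _).coeFn_toLp, ((hφ k).memLp_gradient _).coeFn_toLp⟩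

theorem integral_slice_eq {U : Set (EuclideanSpace ℝ (Fin n))} {a b : ℝ}
    {F : EuclideanSpace ℝ (Fin n) × ℝ → ℝ} (hF : IntegrableOn F (U ×ˢ Set.Ioo a b)) :
    ∫ z in U ×ˢ Set.Ioo a b, F z = ∫ t in Set.Ioo a b, ∫ x in U, F (x, t) := by
  rw [IntegrableOn, Measure.volume_eq_prod, ← Measure.prod_restrict] at hF
  rw [Measure.volume_eq_prod, ← Measure.prod_restrict, integral_prod_symm _ hF]

/-- **Lions–Magenes lemma**: if `w ∈ L²((a,b); W₀^{1,2}(U))` and `∂ₜw = div A` weakly with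
`A ∈ L²`, then `w` has a continuous representative in `L²(U)` obeying the energy identity. -/
theorem exists_isContRep_energy_identity {U : Set (EuclideanSpace ℝ (Fin n))}
    (hUfin : volume U ≠ ⊤) {a b : ℝ} (hab : a < b)
    {w : EuclideanSpace ℝ (Fin n) × ℝ → ℝ}
    {Dw A : EuclideanSpace ℝ (Fin n) × ℝ → EuclideanSpace ℝ (Fin n)}
    (hw : MemL2W12Zero U a b w Dw) (hA : MemLp A 2 (volume.restrict (U ×ˢ Set.Ioo a b)))
    (heq : ∀ φ : EuclideanSpace ℝ (Fin n) × ℝ → ℝ, IsTestFunction (U ×ˢ Set.Ioo a b) φ →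
      ∫ z in U ×ˢ Set.Ioo a b, (w z * deriv (fun s => φ (z.1, s)) z.2
        - inner ℝ (A z) (gradient (fun y => φ (y, z.2)) z.1)) = 0) :
    ∃ W : ℝ → Lp ℝ 2 (volume.restrict U), IsContRep U a b w W ∧
      ‖W b‖ ^ 2 - ‖W a‖ ^ 2 = -(2 * ∫ z in U ×ˢ Set.Ioo a b, inner ℝ (A z) (Dw z)) := by
  have : Fact ((2 : ENNReal) ≠ ⊤) := ⟨by norm_num⟩
  have : IsFiniteMeasure (volume.restrict U) := ⟨by simpa using hUfin.lt_top⟩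
  have hprod : (volume.restrict (U ×ˢ Set.Ioo a b) : Measure (EuclideanSpace ℝ (Fin n) × ℝ))
      = (volume.restrict U).prod (volume.restrict (Set.Ioo a b)) := by
    rw [Measure.prod_restrict, Measure.volume_eq_prod]
  have hw2 := hw.memLp
  have hD2 := hw.memLp_grad
  have hA2 := hA
  rw [hprod] at hw2 hD2 hA2
  obtain ⟨Φ, hΦ, hΦi, hΦe⟩ := exists_curry_memLp_Ioo hw2
  obtain ⟨Ψ, hΨ, hΨi, hΨe⟩ := exists_curry_memLp_Ioo hD2
  obtain ⟨Α, hΑ, hΑi, hΑe⟩ := exists_curry_memLp_Ioo hA2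
  have hwi : Integrable w ((volume.restrict U).prod (volume.restrict (Set.Ioo a b))) :=
    hw2.integrable (by norm_num)
  have hAi : Integrable A ((volume.restrict U).prod (volume.restrict (Set.Ioo a b))) :=
    hA2.integrable (by norm_num)
  -- the increments of `w` tested with a fixed test function
  have htest : ∀ p ∈ testPairs U, ∃ c : ℝ, ∀ᵐ t ∂volume.restrict (Set.Ioo a b),
      (inner ℝ (Φ t) p.1 : ℝ) = c + ∫ s in a..t, -(inner ℝ (Α s) p.2 : ℝ) := by
    rintro p ⟨ψ, hψ, hp1, hp2⟩
    refine exists_ae_eq_const_add_integral hab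
      ((hΦi.inner_const (𝕜 := ℝ) p.1).integrableOn)
      ((hΑi.inner_const (𝕜 := ℝ) p.2).neg.integrableOn) fun χ hχ => ?_
    have hχ1 : ContDiff ℝ 1 χ := hχ.1.of_le (by simp)
    have h := heq _ (hψ.prod_mul hχ)
    have hψd : Differentiable ℝ ψ := hψ.1.differentiable (by simp)
    have hψ1 : ContDiff ℝ 1 ψ := hψ.1.of_le (by simp)
    have e : ∀ z : EuclideanSpace ℝ (Fin n) × ℝ,
        w z * deriv (fun s => ψ z.1 * χ s) z.2
          - inner ℝ (A z) (gradient (fun y => ψ y * χ z.2) z.1)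
        = w z * (ψ z.1 * deriv χ z.2) - χ z.2 * inner ℝ (A z) (gradient ψ z.1) := by
      intro z
      rw [deriv_const_mul_field, gradient_mul_const (hψd z.1), real_inner_smul_right]
    simp only [e] at h
    obtain ⟨C1, hC1⟩ := hψ.bounded
    obtain ⟨C2, hC2⟩ := hχ.2.1.deriv.exists_bound_of_continuous (hχ1.continuous_deriv le_rfl)
    obtain ⟨C3, hC3⟩ := hχ.bounded
    obtain ⟨C4, hC4⟩ := hψ.2.1.gradient.exists_bound_of_continuous (continuous_gradient hψ1)
    have i1 : Integrable (fun z : EuclideanSpace ℝ (Fin n) × ℝ => w z * (ψ z.1 * deriv χ z.2))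
        ((volume.restrict U).prod (volume.restrict (Set.Ioo a b))) := by
      refine hwi.mul_bdd (c := C1 * C2) (Continuous.aestronglyMeasurable ?_)
        (Eventually.of_forall fun z => ?_)
      · exact (hψ.1.continuous.comp continuous_fst).mul
          ((hχ1.continuous_deriv le_rfl).comp continuous_snd)
      · rw [norm_mul]
        exact mul_le_mul (hC1 _) (hC2 _) (norm_nonneg _) ((norm_nonneg _).trans (hC1 0))
    have i2 : Integrable (fun z : EuclideanSpace ℝ (Fin n) × ℝ =>
        χ z.2 * inner ℝ (A z) (gradient ψ z.1))
        ((volume.restrict U).prod (volume.restrict (Set.Ioo a b))) := by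
      refine (hAi.norm.const_mul (C3 * C4)).mono' ?_ (Eventually.of_forall fun z => ?_)
      · exact ((hχ.1.continuous.comp continuous_snd).aestronglyMeasurable).mul
          (hAi.1.inner (𝕜 := ℝ)
            ((continuous_gradient hψ1).comp continuous_fst).aestronglyMeasurable)
      · rw [norm_mul]
        calc ‖χ z.2‖ * ‖(inner ℝ (A z) (gradient ψ z.1) : ℝ)‖
            ≤ C3 * (‖A z‖ * C4) := by
              refine mul_le_mul (hC3 _) ((norm_inner_le_norm _ _).trans ?_) (norm_nonneg _)
                ((norm_nonneg _).trans (hC3 0))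
              exact mul_le_mul_of_nonneg_left (hC4 _) (norm_nonneg _)
          _ = C3 * C4 * ‖A z‖ := by ring
    have i3 := integral_prod_symm _ (i1.sub i2)
    simp only [Pi.sub_apply] at i3
    rw [hprod, i3] at h
    rw [← h]
    refine integral_congr_ae ?_
    filter_upwards [hΦe, hΑe, i1.prod_left_ae, i2.prod_left_ae] with t h1 h2 h3 h4
    rw [integral_sub h3 h4, L2_inner_eq_integral h1 hp1, L2_inner_eq_integral h2 hp2,
      integral_const_mul, ← integral_mul_const, neg_mul, ← sub_eq_add_neg,
      mul_comm (χ t)]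
    congr 1
    refine integral_congr_ae (Eventually.of_forall fun x => ?_)
    simp only [RCLike.inner_apply, conj_trivial]; ring
  choose! c hc using htest
  have : SecondCountableTopology (Lp ℝ 2 (volume.restrict U)) := inferInstance
  have : SecondCountableTopology (Lp (EuclideanSpace ℝ (Fin n)) 2 (volume.restrict U)) :=
    inferInstance
  -- The exceptional null set of times depends on the test pair; a countable dense family leaves a
  -- single null set.
  obtain ⟨S, hST, hSc, hTS⟩ :=
    (TopologicalSpace.IsSeparable.of_separableSpace (testPairs U)).exists_countable_dense_subset
  have hae1 := (ae_ball_iff hSc).2 fun p hp => hc p (hST hp)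
  have hae2 : ∀ᵐ t ∂volume.restrict (Set.Ioo a b), (Φ t, Ψ t) ∈ closure (testPairs U) := by
    filter_upwards [hw.zeroTrace, hΦe, hΨe] with t h1 h2 h3 using h1.mem_closure_testPairs h2 h3
  set E : Set ℝ := {t | (∀ p ∈ S, (inner ℝ (Φ t) p.1 : ℝ)
    = c p + ∫ s in a..t, -(inner ℝ (Α s) p.2 : ℝ)) ∧ (Φ t, Ψ t) ∈ closure (testPairs U)} with hE
  have hEae : ∀ᵐ t, t ∈ Set.Ioo a b → t ∈ E := by
    rw [← ae_restrict_iff' measurableSet_Ioo]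
    filter_upwards [hae1, hae2] with t h1 h2 using ⟨h1, h2⟩
  have hid : ∀ s ∈ E, ∀ t ∈ E, ∀ r ∈ E,
      (inner ℝ (Φ t - Φ s) (Φ r) : ℝ) = -inner ℝ (∫ ρ in s..t, Α ρ) (Ψ r) := by
    intro s hs t ht r hr
    -- For fixed `s` and `t` the identity is continuous in the pair, so it passes from `S` to its
    -- closure, which contains `(Φ r, Ψ r)`.
    have hcl : IsClosed {p : Lp ℝ 2 (volume.restrict U) ×
        Lp (EuclideanSpace ℝ (Fin n)) 2 (volume.restrict U) |
        (inner ℝ (Φ t - Φ s) p.1 : ℝ) = -inner ℝ (∫ ρ in s..t, Α ρ) p.2} :=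
      isClosed_eq (by fun_prop) (by fun_prop)
    have hsub : S ⊆ {p | (inner ℝ (Φ t - Φ s) p.1 : ℝ) = -inner ℝ (∫ ρ in s..t, Α ρ) p.2} := by
      intro p hp
      have hi : Integrable (fun ρ => -(inner ℝ (Α ρ) p.2 : ℝ)) volume := (hΑi.inner_const (𝕜 := ℝ) p.2).neg
      have h1 : ∫ ρ in s..t, -(inner ℝ (Α ρ) p.2 : ℝ) = -inner ℝ (∫ ρ in s..t, Α ρ) p.2 := by
        rw [intervalIntegral.integral_neg]
        congr 1
        have := (innerSL ℝ p.2).intervalIntegral_comp_comm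
          (hΑi.intervalIntegrable (a := s) (b := t))
        simpa only [innerSL_apply_apply, real_inner_comm] using this
      change (inner ℝ (Φ t - Φ s) p.1 : ℝ) = -inner ℝ (∫ ρ in s..t, Α ρ) p.2
      rw [← h1, inner_sub_left, ht.1 p hp, hs.1 p hp,
        ← intervalIntegral.integral_interval_sub_left (a := a) (b := t) (c := s)
          hi.intervalIntegrable hi.intervalIntegrable]
      ring
    have h2 := closure_minimal hTS isClosed_closure hr.2
    exact closure_minimal hsub hcl h2
  obtain ⟨W, hWc, hWe, hWen⟩ := exists_continuousOn_energy_identity hab hΑ hΨ hΑi hΨi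
    ((memLp_two_iff_integrable_sq_norm hΦ.1).1 hΦ) hEae hid
  refine ⟨W, ⟨hWc, ?_⟩, ?_⟩
  · rw [← ae_restrict_iff' measurableSet_Ioo] at hWe
    filter_upwards [hWe, hΦe] with t h1 h2
    rw [h1]; exact h2
  · rw [hWen, integral_slice_eq (integrable_inner hA hw.memLp_grad),
      intervalIntegral.integral_of_le hab.le, integral_Ioc_eq_integral_Ioo]
    congr 2
    refine integral_congr_ae ?_
    filter_upwards [hΑe, hΨe] with t h1 h2 using L2_inner_eq_integral h1 h2

end WeakEquation

/-! ### Space-time test functions and subcylinders -/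

section SpaceTimeTestFunctions

variable {n : ℕ}

theorem IsTestFunction.mono {E : Type*} [NormedAddCommGroup E] [NormedSpace ℝ E] {U V : Set E}
    {φ : E → ℝ} (h : IsTestFunction U φ) (hUV : U ⊆ V) : IsTestFunction V φ :=
  ⟨h.1, h.2.1, h.2.2.trans hUV⟩

theorem deriv_slice_eq {E : Type*} [NormedAddCommGroup E] [NormedSpace ℝ E] {φ : E × ℝ → ℝ}
    (h : Differentiable ℝ φ) (z : E × ℝ) :
    deriv (fun s => φ (z.1, s)) z.2 = fderiv ℝ φ z (0, 1) :=
  ((h z).hasFDerivAt.comp_hasDerivAt z.2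
    ((hasDerivAt_const z.2 z.1).prodMk (hasDerivAt_id z.2))).deriv

theorem gradient_slice_eq {E : Type*} [NormedAddCommGroup E] [InnerProductSpace ℝ E]
    [CompleteSpace E] {φ : E × ℝ → ℝ} (h : Differentiable ℝ φ) (z : E × ℝ) :
    gradient (fun y => φ (y, z.2)) z.1 = (InnerProductSpace.toDual ℝ E).symm
      ((fderiv ℝ φ z).comp (ContinuousLinearMap.inl ℝ E ℝ)) := by
  rw [gradient]
  congr 1
  exact ((h z).hasFDerivAt.comp z.1 (hasFDerivAt_prodMk_left z.1 z.2)).fderiv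

theorem IsTestFunction.memLp_deriv_slice
    {W : Set (EuclideanSpace ℝ (Fin n) × ℝ)} {φ : EuclideanSpace ℝ (Fin n) × ℝ → ℝ}
    (h : IsTestFunction W φ) (μ : Measure (EuclideanSpace ℝ (Fin n) × ℝ))
    [IsFiniteMeasureOnCompacts μ] :
    MemLp (fun z => deriv (fun s => φ (z.1, s)) z.2) 2 μ := by
  simp only [deriv_slice_eq (h.1.differentiable (by simp))]
  refine Continuous.memLp_of_hasCompactSupport ?_ ?_
  · exact (h.1.continuous_fderiv (by simp)).clm_apply continuous_const
  · exact (h.2.1.fderiv ℝ).comp_left (g := fun L : _ →L[ℝ] ℝ => L (0, 1)) rfl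

theorem IsTestFunction.memLp_gradient_slice
    {W : Set (EuclideanSpace ℝ (Fin n) × ℝ)} {φ : EuclideanSpace ℝ (Fin n) × ℝ → ℝ}
    (h : IsTestFunction W φ) (μ : Measure (EuclideanSpace ℝ (Fin n) × ℝ))
    [IsFiniteMeasureOnCompacts μ] :
    MemLp (fun z => gradient (fun y => φ (y, z.2)) z.1) 2 μ := by
  simp only [gradient_slice_eq (h.1.differentiable (by simp))]
  refine Continuous.memLp_of_hasCompactSupport ?_ ?_
  · exact (InnerProductSpace.toDual ℝ _).symm.continuous.comp
      ((h.1.continuous_fderiv (by simp)).clm_comp continuous_const)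
  · refine (h.2.1.fderiv ℝ).comp_left (g := fun L : (EuclideanSpace ℝ (Fin n) × ℝ) →L[ℝ] ℝ =>
      (InnerProductSpace.toDual ℝ (EuclideanSpace ℝ (Fin n))).symm
        (L.comp (ContinuousLinearMap.inl ℝ (EuclideanSpace ℝ (Fin n)) ℝ))) ?_
    simp

theorem IsTestFunction.slices_eq_zero
    {W : Set (EuclideanSpace ℝ (Fin n) × ℝ)} {φ : EuclideanSpace ℝ (Fin n) × ℝ → ℝ}
    (h : IsTestFunction W φ) {z : EuclideanSpace ℝ (Fin n) × ℝ} (hz : z ∉ W) :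
    deriv (fun s => φ (z.1, s)) z.2 = 0 ∧ gradient (fun y => φ (y, z.2)) z.1 = 0 := by
  have h0 : fderiv ℝ φ z = 0 := by
    by_contra hne
    exact hz (h.2.2 (support_fderiv_subset ℝ hne))
  rw [deriv_slice_eq (h.1.differentiable (by simp)),
    gradient_slice_eq (h.1.differentiable (by simp)), h0]
  simp

/-- The weak formulation restricts to smaller cylinders. -/
theorem SatisfiesWeakEq.mono {F : EuclideanSpace ℝ (Fin n) → ℝ}
    {U U' : Set (EuclideanSpace ℝ (Fin n))} {a b a' b' : ℝ}
    {v : EuclideanSpace ℝ (Fin n) × ℝ → ℝ}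
    {Dv : EuclideanSpace ℝ (Fin n) × ℝ → EuclideanSpace ℝ (Fin n)}
    (h : SatisfiesWeakEq F U a b v Dv) (hU : IsOpen U) (hUU : U' ⊆ U) (ha : a ≤ a')
    (hb : b' ≤ b) : SatisfiesWeakEq F U' a' b' v Dv := by
  intro φ hφ
  have hsub : U' ×ˢ Set.Ioo a' b' ⊆ U ×ˢ Set.Ioo a b :=
    Set.prod_mono hUU (Set.Ioo_subset_Ioo ha hb)
  rw [← h φ (hφ.mono hsub)]
  refine (setIntegral_eq_of_subset_of_forall_sdiff_eq_zero
    (hU.measurableSet.prod measurableSet_Ioo) hsub fun z hz => ?_).symm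
  obtain ⟨h1, h2⟩ := hφ.slices_eq_zero hz.2
  rw [h1, h2]; simp

end SpaceTimeTestFunctions

/-! ### Integrability and coercivity of the fluxes -/

section Fluxes

variable {n : ℕ} {α : Type*} [MeasurableSpace α] {μ : Measure α}

theorem memLp_comp_of_abs_le [IsFiniteMeasure μ] {f : ℝ → ℝ} {g : α → ℝ} (hf : Continuous f)
    {C : ℝ} (hC : ∀ s, |f s| ≤ |s| + C) (hg : MemLp g 2 μ) : MemLp (fun z => f (g z)) 2 μ := by
  refine (hg.norm.add (memLp_const C)).mono (hf.comp_aestronglyMeasurable hg.1)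
    (Eventually.of_forall fun z => ?_)
  exact (hC (g z)).trans (le_abs_self _)

variable {δ : Fin n → ℝ} {ε : ℝ}

theorem memLp_gDegD [IsFiniteMeasure μ] {d : ℝ} (hd : 0 ≤ d) {g : α → ℝ} (hg : MemLp g 2 μ) :
    MemLp (fun z => gDegD d (g z)) 2 μ :=
  memLp_comp_of_abs_le (continuous_gDegD d) (C := 0)
    (fun s => by rw [add_zero]; exact abs_gDegD_le hd s) hg

theorem memLp_KEps [IsFiniteMeasure μ] {d : ℝ} (hε : 0 < ε) (hd0 : 0 ≤ d) (hd : 0 < d → ε < d)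
    {g : α → ℝ} (hg : MemLp g 2 μ) : MemLp (fun z => KEps d ε (g z)) 2 μ :=
  memLp_comp_of_abs_le (continuous_KEps hε hd0 hd) (C := 0)
    (fun s => by simpa [KEps_zero] using abs_KEps_sub_le hε hd0 hd 0 s) hg

theorem memLp_gradient_F0 [IsFiniteMeasure μ] (hδ : ∀ i, 0 ≤ δ i)
    {G : α → EuclideanSpace ℝ (Fin n)} (hG : MemLp G 2 μ) :
    MemLp (fun z => gradient (F0 δ) (G z)) 2 μ := by
  refine MemLp.of_eval_piLp fun i => ?_
  simp only [gradient_F0 hδ]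
  exact memLp_gDegD (hδ i) (hG.eval_piLp i)

theorem memLp_gradient_FEps [IsFiniteMeasure μ] (hδ : ∀ i, 0 ≤ δ i) (hε : AdmissibleEps δ ε)
    {G : α → EuclideanSpace ℝ (Fin n)} (hG : MemLp G 2 μ) :
    MemLp (fun z => gradient (FEps δ ε) (G z)) 2 μ := by
  refine MemLp.of_eval_piLp fun i => ?_
  simp only [gradient_FEps hδ hε]
  refine (memLp_comp_of_abs_le (continuous_gTildeD (δ i) hε.1) (C := ε / 4) (fun s => ?_)
    (hG.eval_piLp i)).add ((hG.eval_piLp i).const_mul ε)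
  have h1 := abs_gTildeD_sub_gDegD_le hε.1 (hδ i) (hε.2.2 i) s
  have h2 := abs_gDegD_le (hδ i) s
  have h3 := abs_sub_abs_le_abs_sub (gTildeD (δ i) ε s) (gDegD (δ i) s)
  linarith

/-- Coercivity of the difference of the regularized and the degenerate flux. -/
theorem le_inner_gradient_sub (hδ : ∀ i, 0 ≤ δ i) (hε : AdmissibleEps δ ε)
    (ξ η : EuclideanSpace ℝ (Fin n)) :
    ∑ i, |KEps (δ i) ε (ξ i) - KEps (δ i) ε (η i)| ^ 2 + ε / 2 * ‖ξ - η‖ ^ 2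
      - ε * (‖η‖ ^ 2 + n / 16)
      ≤ inner ℝ (gradient (FEps δ ε) ξ - gradient (F0 δ) η) (ξ - η) := by
  rw [gradient_FEps hδ hε, gradient_F0 hδ, PiLp.inner_apply, EuclideanSpace.norm_sq_eq,
    EuclideanSpace.norm_sq_eq]
  have hn : (n : ℝ) / 16 = ∑ _i : Fin n, (1 / 16 : ℝ) := by simp; ring
  rw [hn, ← Finset.sum_add_distrib, Finset.mul_sum, Finset.mul_sum, ← Finset.sum_add_distrib,
    ← Finset.sum_sub_distrib]
  refine Finset.sum_le_sum fun i _ => ?_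
  simp only [PiLp.sub_apply, Real.norm_eq_abs, sq_abs, RCLike.inner_apply, conj_trivial]
  have h1 := KEps_sub_sq_le hε.1 (hδ i) (hε.2.2 i) (η i) (ξ i)
  have h2 := abs_le.1 (abs_gTildeD_sub_gDegD_le hε.1 (hδ i) (hε.2.2 i) (η i))
  have hε0 := hε.1
  set x := ξ i
  set y := η i
  set r := gTildeD (δ i) ε y - gDegD (δ i) y with hr
  -- Young's inequality with `|r| ≤ ε/4`, obtained from the square `(r + ε(x-y)/2)² ≥ 0` and
  -- multiplied by `ε` to avoid division.
  have h3 : -(ε * (1 / 4 * (x - y) ^ 2 + 1 / 16)) ≤ r * (x - y) := by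
    have hr2 : r ^ 2 ≤ (ε / 4) ^ 2 := sq_le_sq' h2.1 h2.2
    have : 0 ≤ (r + ε / 2 * (x - y)) ^ 2 := sq_nonneg _
    have h4 : -(ε * (1 / 4 * (x - y) ^ 2 + 1 / 16)) * ε ≤ r * (x - y) * ε := by nlinarith
    exact le_of_mul_le_mul_right h4 hε0
  -- This square gives `εx(x-y) ≥ (3/4)ε(x-y)² - εy²`. After the loss of `(1/4)ε(x-y)²` in `h3`, the
  -- coefficient `ε/2` remains.
  have h5 : 0 ≤ ε * ((x - y) / 2 + y) ^ 2 := by positivity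
  have h6 : (x - y) * (gTildeD (δ i) ε x + ε * x - gDegD (δ i) y)
      = (gTildeD (δ i) ε x - gTildeD (δ i) ε y) * (x - y) + r * (x - y) + ε * x * (x - y) := by
    rw [hr]; ring
  nlinarith

end Fluxes

/-! ### Initial values and the comparison estimate -/

section Comparison

variable {n : ℕ}

/-- Right neighbourhoods have positive measure; hence essential one-sided limits are unique. -/
theorem neBot_nhdsGT_inf_ae (a : ℝ) : (𝓝[>] a ⊓ ae (volume : Measure ℝ)).NeBot := by
  rw [inf_neBot_iff]
  intro s hs t ht
  obtain ⟨c, hc, hsub⟩ := mem_nhdsGT_iff_exists_Ioo_subset.1 hs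
  have hc : a < c := hc
  by_contra hemp
  have hpos : volume (Set.Ioo a c) ≠ 0 := by simpa using hc
  refine hpos (measure_mono_null (fun y hy => ?_) (mem_ae_iff.1 ht))
  exact fun hyt => hemp ⟨y, hsub hy, hyt⟩

theorem IsContRep.apply_left_eq_zero {U : Set (EuclideanSpace ℝ (Fin n))} {a b : ℝ} (hab : a < b)
    {w : EuclideanSpace ℝ (Fin n) × ℝ → ℝ} {W : ℝ → Lp ℝ 2 (volume.restrict U)}
    (hW : IsContRep U a b w W)
    (h : Tendsto (fun t => eLpNorm (fun x => w (x, t)) 2 (volume.restrict U))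
      (𝓝[>] a ⊓ ae volume) (𝓝 0)) : W a = 0 := by
  have := neBot_nhdsGT_inf_ae a
  have hle : 𝓝[>] a ⊓ ae (volume : Measure ℝ) ≤ 𝓝[Set.Icc a b] a :=
    inf_le_left.trans ((nhdsWithin_Ioo_eq_nhdsGT hab).symm.le.trans
      (nhdsWithin_mono a Set.Ioo_subset_Icc_self))
  have h1 : Tendsto (fun t => ‖W t‖) (𝓝[>] a ⊓ ae volume) (𝓝 ‖W a‖) :=
    ((hW.1 a (Set.left_mem_Icc.2 hab.le)).mono_left hle).norm
  have h2 : (fun t => (eLpNorm (fun x => w (x, t)) 2 (volume.restrict U)).toReal)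
      =ᶠ[𝓝[>] a ⊓ ae volume] fun t => ‖W t‖ := by
    have e1 : ∀ᶠ t in 𝓝[>] a ⊓ ae volume, t ∈ Set.Ioo a b :=
      (inf_le_left : 𝓝[>] a ⊓ ae volume ≤ _) (Ioo_mem_nhdsGT hab)
    have e2 : ∀ᶠ t in 𝓝[>] a ⊓ ae (volume : Measure ℝ), t ∈ Set.Ioo a b →
        W t =ᵐ[volume.restrict U] fun x => w (x, t) :=
      (inf_le_right : 𝓝[>] a ⊓ ae volume ≤ _) ((ae_restrict_iff' measurableSet_Ioo).1 hW.2)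
    filter_upwards [e1, e2] with t h1 h2
    rw [Lp.norm_def, eLpNorm_congr_ae (h2 h1)]
  have h3 := ((ENNReal.tendsto_toReal ENNReal.zero_ne_top).comp h).congr' h2
  rw [ENNReal.toReal_zero] at h3
  exact norm_eq_zero.1 (tendsto_nhds_unique h1 h3)

/-- The comparison estimate between a solution of the degenerate equation and a solution of the
regularized problem with the same parabolic boundary values. -/
theorem exists_comparison_estimate {Ω Ω' : Set (EuclideanSpace ℝ (Fin n))}
    {T₀ T₁ τ₀ τ₁ ε : ℝ} {δ : Fin n → ℝ} {u v : EuclideanSpace ℝ (Fin n) × ℝ → ℝ}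
    {Du Dv : EuclideanSpace ℝ (Fin n) × ℝ → EuclideanSpace ℝ (Fin n)}
    (hΩ : IsOpen Ω) (hΩ' : IsOpen Ω') (hK : IsCompact (closure Ω')) (hΩΩ : closure Ω' ⊆ Ω)
    (h0 : T₀ < τ₀) (hτ : τ₀ < τ₁) (h1 : τ₁ < T₁) (hδ : ∀ i, 0 ≤ δ i)
    (hu : IsLocalWeakSolution δ Ω T₀ T₁ u Du) (hε : AdmissibleEps δ ε)
    (hv : IsCauchyDirichletSolution δ ε Ω' τ₀ τ₁ u Du v Dv) :
    ∃ U V : ℝ → Lp ℝ 2 (volume.restrict Ω'),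
      IsContRep Ω' τ₀ τ₁ u U ∧ IsContRep Ω' τ₀ τ₁ v V ∧
      (∫ x in Ω', |V τ₁ x - U τ₁ x| ^ 2)
        + ∑ i, (∫ z in Ω' ×ˢ Set.Ioo τ₀ τ₁,
            |KEps (δ i) ε (Dv z i) - KEps (δ i) ε (Du z i)| ^ 2)
        + ε * (∫ z in Ω' ×ˢ Set.Ioo τ₀ τ₁, ‖Dv z - Du z‖ ^ 2)
        ≤ (n + 2) * ε * (volume.real (Ω' ×ˢ Set.Ioo τ₀ τ₁)
            + ∫ z in Ω' ×ˢ Set.Ioo τ₀ τ₁, ‖Du z‖ ^ 2) := by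
  have hfin : volume Ω' ≠ ⊤ := ((measure_mono subset_closure).trans_lt hK.measure_lt_top).ne
  set Q := Ω' ×ˢ Set.Ioo τ₀ τ₁ with hQ
  have hQfin : volume Q < ⊤ := by
    rw [hQ, Measure.volume_eq_prod, Measure.prod_prod]
    exact ENNReal.mul_lt_top hfin.lt_top measure_Ioo_lt_top
  have : IsFiniteMeasure (volume.restrict Q) := ⟨by simpa using hQfin⟩
  have hu' := hu.memLoc Ω' τ₀ τ₁ hΩ' hK hΩΩ h0 hτ h1
  have hueq : SatisfiesWeakEq (F0 δ) Ω' τ₀ τ₁ u Du :=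
    hu.weakEq.mono hΩ (subset_closure.trans hΩΩ) h0.le h1.le
  set A : EuclideanSpace ℝ (Fin n) × ℝ → EuclideanSpace ℝ (Fin n) :=
    fun z => gradient (FEps δ ε) (Dv z) - gradient (F0 δ) (Du z) with hA
  have hFv : MemLp (fun z => gradient (FEps δ ε) (Dv z)) 2 (volume.restrict Q) :=
    memLp_gradient_FEps hδ hε hv.mem.memLp_grad
  have hFu : MemLp (fun z => gradient (F0 δ) (Du z)) 2 (volume.restrict Q) :=
    memLp_gradient_F0 hδ hu'.memLp_grad
  have hA2 : MemLp A 2 (volume.restrict Q) := hFv.sub hFu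
  obtain ⟨W, hW, hWen⟩ := exists_isContRep_energy_identity hfin hτ hv.lateral hA2 (by
    intro φ hφ
    have e1 := hv.weakEq φ hφ
    have e2 := hueq φ hφ
    have ht := hφ.memLp_deriv_slice (volume.restrict Q)
    have hg := hφ.memLp_gradient_slice (volume.restrict Q)
    have i1 := (hv.mem.memLp.integrable_mul ht).sub (integrable_inner hFv hg)
    have i2 := (hu'.memLp.integrable_mul ht).sub (integrable_inner hFu hg)
    have e3 := integral_sub i1 i2
    simp only [Pi.sub_apply, Pi.mul_apply] at e3
    rw [e1, e2, sub_zero] at e3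
    rw [← e3]
    congr 1
    ext z
    simp only [hA, inner_sub_left]
    ring)
  have hW0 : W τ₀ = 0 := hW.apply_left_eq_zero hτ hv.initial
  rw [hW0, norm_zero] at hWen
  obtain ⟨V, hV⟩ := hv.cont
  -- Continuity in time of `u` is inherited from `v` and `w` through `u = v - w`.
  refine ⟨fun t => V t - W t, V, ⟨hV.1.sub hW.1, ?_⟩, hV, ?_⟩
  · filter_upwards [hV.2, hW.2] with t e1 e2
    filter_upwards [Lp.coeFn_sub (V t) (W t), e1, e2] with x f1 f2 f3
    rw [f1, Pi.sub_apply, f2, f3]; ring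
  have hWsq : ∫ x in Ω', |V τ₁ x - (V τ₁ - W τ₁ : Lp ℝ 2 (volume.restrict Ω')) x| ^ 2
      = ‖W τ₁‖ ^ 2 := by
    rw [L2_norm_sq_eq_integral (EventuallyEq.refl _ (W τ₁))]
    refine integral_congr_ae ?_
    filter_upwards [Lp.coeFn_sub (V τ₁) (W τ₁)] with x hx
    rw [hx, Pi.sub_apply, sub_sub_cancel, Real.norm_eq_abs]
  rw [hWsq]
  have iK : ∀ i, Integrable (fun z => |KEps (δ i) ε (Dv z i) - KEps (δ i) ε (Du z i)| ^ 2)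
      (volume.restrict Q) := by
    intro i
    have := ((memLp_KEps hε.1 (hδ i) (hε.2.2 i) (hv.mem.memLp_grad.eval_piLp i)).sub
      (memLp_KEps hε.1 (hδ i) (hε.2.2 i) (hu'.memLp_grad.eval_piLp i)))
    exact (memLp_two_iff_integrable_sq_norm this.1).1 this
  have iW : Integrable (fun z => ‖Dv z - Du z‖ ^ 2) (volume.restrict Q) :=
    (memLp_two_iff_integrable_sq_norm hv.lateral.memLp_grad.1).1 hv.lateral.memLp_grad
  have iu : Integrable (fun z => ‖Du z‖ ^ 2) (volume.restrict Q) :=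
    (memLp_two_iff_integrable_sq_norm hu'.memLp_grad.1).1 hu'.memLp_grad
  have hmono := integral_mono (((integrable_finsetSum Finset.univ fun i _ => iK i).add
      (iW.const_mul (ε / 2))).sub ((iu.add (integrable_const ((n : ℝ) / 16))).const_mul ε))
    (integrable_inner hA2 hv.lateral.memLp_grad)
    (fun z => le_inner_gradient_sub hδ hε (Dv z) (Du z))
  rw [integral_sub' ((integrable_finsetSum Finset.univ fun i _ => iK i).add
      (iW.const_mul (ε / 2))) ((iu.add (integrable_const ((n : ℝ) / 16))).const_mul ε),
    integral_add' (integrable_finsetSum Finset.univ fun i _ => iK i) (iW.const_mul (ε / 2)),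
    integral_finsetSum _ (fun i _ => iK i), integral_const_mul, integral_const_mul] at hmono
  rw [integral_add' iu (integrable_const _), integral_const, smul_eq_mul,
    measureReal_restrict_apply_univ] at hmono
  have hKnn : 0 ≤ ∑ i, ∫ z in Q, |KEps (δ i) ε (Dv z i) - KEps (δ i) ε (Du z i)| ^ 2 :=
    Finset.sum_nonneg fun i _ => integral_nonneg fun z => by positivity
  have hunn : 0 ≤ ∫ z in Q, ‖Du z‖ ^ 2 := integral_nonneg fun z => by positivity
  have hvol : 0 ≤ volume.real Q := measureReal_nonneg
  have hn0 : (0 : ℝ) ≤ n := Nat.cast_nonneg n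
  have hε0 := hε.1
  -- Twice the coercivity inequality turns `ε/2` into `ε` and leaves this error; `n + 2` dominates
  -- both factors `2` and `n/8`. The surplus copy of the `K` terms is dropped.
  have b1 : 2 * ε * ((∫ z in Q, ‖Du z‖ ^ 2) + volume.real Q * (n / 16))
      ≤ (n + 2) * ε * (volume.real Q + ∫ z in Q, ‖Du z‖ ^ 2) := by
    have c1 : 0 ≤ n * (ε * ∫ z in Q, ‖Du z‖ ^ 2) := by positivity
    have c2 : 0 ≤ n * (ε * volume.real Q) := by positivity
    have c3 : 0 ≤ ε * volume.real Q := by positivity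
    nlinarith
  simp only [hA] at hWen hmono
  linarith

theorem eLpNorm_le_ofReal_sqrt {α : Type*} [MeasurableSpace α] {μ : Measure α} {f : α → ℝ}
    (hf : MemLp f 2 μ) {C : ℝ} (h : ∫ z, |f z| ^ 2 ∂μ ≤ C) :
    eLpNorm f 2 μ ≤ ENNReal.ofReal √C := by
  have h1 := L2_norm_sq_eq_integral hf.coeFn_toLp
  simp only [Real.norm_eq_abs] at h1
  rw [← h1] at h
  rw [← ENNReal.ofReal_toReal hf.2.ne, ← Lp.norm_toLp f hf]
  exact ENNReal.ofReal_le_ofReal (Real.le_sqrt_of_sq_le h)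

theorem eventually_admissibleEps (δ : Fin n → ℝ) : ∀ᶠ ε in 𝓝[>] (0 : ℝ), AdmissibleEps δ ε := by
  have h : ∀ i, ∀ᶠ ε in 𝓝[>] (0 : ℝ), 0 < δ i → ε < δ i := by
    intro i
    by_cases hi : 0 < δ i
    · filter_upwards [Ioo_mem_nhdsGT hi] with ε hε _ using hε.2
    · exact Eventually.of_forall fun _ h => absurd h hi
  filter_upwards [self_mem_nhdsWithin, Ioo_mem_nhdsGT one_pos, eventually_all.2 h]
    with ε h1 h2 h3 using ⟨h1, h2.2, h3⟩

end Comparison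

/-! ### Energy estimate, gradient bound and strong convergence -/

theorem proposition5p2 (n : ℕ) (hn : 2 ≤ n) :
    ∃ c : ℝ, 0 < c ∧
      ∀ (Ω Ω' : Set (EuclideanSpace ℝ (Fin n))) (T₀ T₁ τ₀ τ₁ : ℝ) (δ : Fin n → ℝ)
        (u : EuclideanSpace ℝ (Fin n) × ℝ → ℝ)
        (Du : EuclideanSpace ℝ (Fin n) × ℝ → EuclideanSpace ℝ (Fin n)),
        IsOpen Ω → Bornology.IsBounded Ω →
        IsOpen Ω' → IsCompact (closure Ω') → closure Ω' ⊆ Ω →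
        T₀ < τ₀ → τ₀ < τ₁ → τ₁ < T₁ →
        (∀ i, 0 ≤ δ i) →
        IsLocalWeakSolution δ Ω T₀ T₁ u Du →
        -- the energy estimate and the uniform gradient bound, for each single `ε`
        (∀ (ε : ℝ) (v : EuclideanSpace ℝ (Fin n) × ℝ → ℝ)
          (Dv : EuclideanSpace ℝ (Fin n) × ℝ → EuclideanSpace ℝ (Fin n)),
          AdmissibleEps δ ε →
          IsCauchyDirichletSolution δ ε Ω' τ₀ τ₁ u Du v Dv →
          (∃ U V : ℝ → Lp ℝ 2 (volume.restrict Ω'),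
            IsContRep Ω' τ₀ τ₁ u U ∧ IsContRep Ω' τ₀ τ₁ v V ∧
            (∀ i, MemLp (fun z => KEps (δ i) ε (Dv z i) - KEps (δ i) ε (Du z i)) 2
              (volume.restrict (Ω' ×ˢ Set.Ioo τ₀ τ₁))) ∧
            (∫ x in Ω', |V τ₁ x - U τ₁ x| ^ 2)
              + ∑ i, (∫ z in Ω' ×ˢ Set.Ioo τ₀ τ₁,
                  |KEps (δ i) ε (Dv z i) - KEps (δ i) ε (Du z i)| ^ 2)
              + ε * (∫ z in Ω' ×ˢ Set.Ioo τ₀ τ₁, ‖Dv z - Du z‖ ^ 2)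
              ≤ c * ε * (volume.real (Ω' ×ˢ Set.Ioo τ₀ τ₁)
                  + ∫ z in Ω' ×ˢ Set.Ioo τ₀ τ₁, ‖Du z‖ ^ 2)) ∧
          (∫ z in Ω' ×ˢ Set.Ioo τ₀ τ₁, ‖Dv z‖ ^ 2)
            ≤ 2 * (c + 1) * (volume.real (Ω' ×ˢ Set.Ioo τ₀ τ₁)
                + ∫ z in Ω' ×ˢ Set.Ioo τ₀ τ₁, ‖Du z‖ ^ 2)) ∧
        -- strong convergence as `ε ↓ 0`
        (∀ (uε : ℝ → EuclideanSpace ℝ (Fin n) × ℝ → ℝ)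
          (Duε : ℝ → EuclideanSpace ℝ (Fin n) × ℝ → EuclideanSpace ℝ (Fin n)),
          (∀ ε, AdmissibleEps δ ε →
            IsCauchyDirichletSolution δ ε Ω' τ₀ τ₁ u Du (uε ε) (Duε ε)) →
          ∀ j,
            MemLp (fun z => HFun (δ j) (Du z j)) 2 (volume.restrict (Ω' ×ˢ Set.Ioo τ₀ τ₁)) ∧
            (∀ ε, AdmissibleEps δ ε →
              MemLp (fun z => KEps (δ j) ε (Duε ε z j)) 2
                (volume.restrict (Ω' ×ˢ Set.Ioo τ₀ τ₁))) ∧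
            Tendsto
              (fun ε => eLpNorm
                (fun z => KEps (δ j) ε (Duε ε z j) - HFun (δ j) (Du z j)) 2
                (volume.restrict (Ω' ×ˢ Set.Ioo τ₀ τ₁)))
              (𝓝[>] 0) (𝓝 0)) := by
  refine ⟨n + 2, by positivity, ?_⟩
  intro Ω Ω' T₀ T₁ τ₀ τ₁ δ u Du hΩ _ hΩ' hK hΩΩ h0 hτ h1 hδ hu
  have hu' := hu.memLoc Ω' τ₀ τ₁ hΩ' hK hΩΩ h0 hτ h1
  have hfin : volume Ω' ≠ ⊤ := ((measure_mono subset_closure).trans_lt hK.measure_lt_top).ne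
  have hQfin : volume (Ω' ×ˢ Set.Ioo τ₀ τ₁) < ⊤ := by
    rw [Measure.volume_eq_prod, Measure.prod_prod]
    exact ENNReal.mul_lt_top hfin.lt_top measure_Ioo_lt_top
  have : IsFiniteMeasure (volume.restrict (Ω' ×ˢ Set.Ioo τ₀ τ₁)) := ⟨by simpa using hQfin⟩
  have hest := fun (ε : ℝ) v Dv (hε : AdmissibleEps δ ε)
    (hv : IsCauchyDirichletSolution δ ε Ω' τ₀ τ₁ u Du v Dv) =>
    exists_comparison_estimate hΩ hΩ' hK hΩΩ h0 hτ h1 hδ hu hε hv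
  set Q := Ω' ×ˢ Set.Ioo τ₀ τ₁ with hQ
  set M := volume.real Q + ∫ z in Q, ‖Du z‖ ^ 2 with hM
  have iu : Integrable (fun z => ‖Du z‖ ^ 2) (volume.restrict Q) :=
    (memLp_two_iff_integrable_sq_norm hu'.memLp_grad.1).1 hu'.memLp_grad
  have hKu : ∀ ε, AdmissibleEps δ ε → ∀ i,
      MemLp (fun z => KEps (δ i) ε (Du z i)) 2 (volume.restrict Q) := fun ε hε i =>
    memLp_KEps hε.1 (hδ i) (hε.2.2 i) (hu'.memLp_grad.eval_piLp i)
  have hKv : ∀ ε v Dv, AdmissibleEps δ ε →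
      IsCauchyDirichletSolution δ ε Ω' τ₀ τ₁ u Du v Dv → ∀ i,
      MemLp (fun z => KEps (δ i) ε (Dv z i)) 2 (volume.restrict Q) := fun ε v Dv hε hv i =>
    memLp_KEps hε.1 (hδ i) (hε.2.2 i) (hv.mem.memLp_grad.eval_piLp i)
  have hvol : 0 ≤ volume.real Q := measureReal_nonneg
  have hunn : 0 ≤ ∫ z in Q, ‖Du z‖ ^ 2 := integral_nonneg fun z => by positivity
  have hKnn : ∀ ε (Dv : EuclideanSpace ℝ (Fin n) × ℝ → EuclideanSpace ℝ (Fin n)) i,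
      0 ≤ ∫ z in Q, |KEps (δ i) ε (Dv z i) - KEps (δ i) ε (Du z i)| ^ 2 :=
    fun ε Dv i => integral_nonneg fun z => by positivity
  refine ⟨fun ε v Dv hε hv => ?_, fun uε Duε hsol j => ?_⟩
  · obtain ⟨U, V, hU, hV, hle⟩ := hest ε v Dv hε hv
    refine ⟨⟨U, V, hU, hV, fun i => (hKv ε v Dv hε hv i).sub (hKu ε hε i), hle⟩, ?_⟩
    have hW0 : 0 ≤ ∫ x in Ω', |V τ₁ x - U τ₁ x| ^ 2 := integral_nonneg fun x => by positivity
    have hK0 := Finset.sum_nonneg fun i (_ : i ∈ Finset.univ) => hKnn ε Dv i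
    -- Both sides of the estimate carry a factor `ε`; cancelling it gives a gradient bound uniform
    -- in `ε`.
    have hD : ε * (∫ z in Q, ‖Dv z - Du z‖ ^ 2) ≤ ε * ((n + 2) * M) := by
      rw [show ε * ((n + 2) * M) = (n + 2) * ε * M by ring]
      linarith
    have hD := le_of_mul_le_mul_left hD hε.1
    have iW : Integrable (fun z => ‖Dv z - Du z‖ ^ 2) (volume.restrict Q) :=
      (memLp_two_iff_integrable_sq_norm hv.lateral.memLp_grad.1).1 hv.lateral.memLp_grad
    have iv : Integrable (fun z => ‖Dv z‖ ^ 2) (volume.restrict Q) :=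
      (memLp_two_iff_integrable_sq_norm hv.mem.memLp_grad.1).1 hv.mem.memLp_grad
    have hsum := integral_mono iv ((iW.const_mul 2).add (iu.const_mul 2)) (fun z => by
      simp only [Pi.add_apply]
      have h2 : ‖Dv z‖ ≤ ‖Dv z - Du z‖ + ‖Du z‖ := by
        simpa using norm_add_le (Dv z - Du z) (Du z)
      have h3 := pow_le_pow_left₀ (norm_nonneg _) h2 2
      nlinarith [sq_nonneg (‖Dv z - Du z‖ - ‖Du z‖)])
    rw [integral_add' (iW.const_mul 2) (iu.const_mul 2), integral_const_mul,
      integral_const_mul] at hsum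
    linarith
  · have hH : MemLp (fun z => HFun (δ j) (Du z j)) 2 (volume.restrict Q) := by
      simp only [HFun_eq (hδ j)]
      exact memLp_gDegD (hδ j) (hu'.memLp_grad.eval_piLp j)
    refine ⟨hH, fun ε hε => hKv ε _ _ hε (hsol ε hε) j, ?_⟩
    -- Inserting `K_ε(∂_j u)` splits the error into a part of order `√ε` from the energy estimate
    -- and a part bounded pointwise by `2ε` on a set of finite measure.
    have hbound : ∀ᶠ ε in 𝓝[>] (0 : ℝ), eLpNorm
        (fun z => KEps (δ j) ε (Duε ε z j) - HFun (δ j) (Du z j)) 2 (volume.restrict Q)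
        ≤ ENNReal.ofReal √((n + 2) * ε * M)
          + volume.restrict Q Set.univ ^ (2 : ENNReal).toReal⁻¹ * ENNReal.ofReal (2 * ε) := by
      filter_upwards [eventually_admissibleEps δ] with ε hε
      have hv := hsol ε hε
      obtain ⟨U, V, -, -, hle⟩ := hest ε _ _ hε hv
      have m1 := hKv ε _ _ hε hv j
      have m2 := hKu ε hε j
      have e : (fun z => KEps (δ j) ε (Duε ε z j) - HFun (δ j) (Du z j))
          = (fun z => KEps (δ j) ε (Duε ε z j) - KEps (δ j) ε (Du z j))
            + fun z => KEps (δ j) ε (Du z j) - HFun (δ j) (Du z j) := by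
        ext z; simp
      rw [e]
      refine (eLpNorm_add_le (m1.sub m2).1 (m2.sub hH).1 (by norm_num)).trans
        (add_le_add ?_ ?_)
      · refine eLpNorm_le_ofReal_sqrt (m1.sub m2) ?_
        have hW0 : 0 ≤ ∫ x in Ω', |V τ₁ x - U τ₁ x| ^ 2 := integral_nonneg fun x => by positivity
        have hK0 := Finset.single_le_sum (fun i (_ : i ∈ Finset.univ) => hKnn ε (Duε ε) i)
          (Finset.mem_univ j)
        have hD0 : 0 ≤ ε * (∫ z in Q, ‖Duε ε z - Du z‖ ^ 2) :=
          mul_nonneg hε.1.le (integral_nonneg fun z => by positivity)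
        simp only [Pi.sub_apply]
        linarith
      · refine eLpNorm_le_of_ae_bound (Eventually.of_forall fun z => ?_)
        simp only [Pi.sub_apply, HFun_eq (hδ j)]
        exact abs_KEps_sub_gDegD_le hε.1 (hδ j) (hε.2.2 j) _
    refine tendsto_of_tendsto_of_tendsto_of_le_of_le' tendsto_const_nhds ?_
      (Eventually.of_forall fun _ => zero_le) hbound
    have t1 : Tendsto (fun ε : ℝ => ENNReal.ofReal √((n + 2) * ε * M)) (𝓝[>] 0) (𝓝 0) := by
      have : Continuous fun ε : ℝ => ENNReal.ofReal √((n + 2) * ε * M) :=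
        ENNReal.continuous_ofReal.comp (by fun_prop)
      have := this.tendsto 0
      simp only [mul_zero, zero_mul, Real.sqrt_zero, ENNReal.ofReal_zero] at this
      exact this.mono_left nhdsWithin_le_nhds
    have t2 : Tendsto (fun ε : ℝ => volume.restrict Q Set.univ ^ (2 : ENNReal).toReal⁻¹
        * ENNReal.ofReal (2 * ε)) (𝓝[>] 0) (𝓝 0) := by
      have h2 : Continuous fun ε : ℝ => ENNReal.ofReal (2 * ε) :=
        ENNReal.continuous_ofReal.comp (by fun_prop)
      have h3 := h2.tendsto 0
      simp only [mul_zero, ENNReal.ofReal_zero] at h3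
      have h4 := ENNReal.Tendsto.const_mul (a := volume.restrict Q Set.univ ^ (2 : ENNReal).toReal⁻¹)
        (h3.mono_left (nhdsWithin_le_nhds (s := Set.Ioi 0))) (Or.inr (by finiteness))
      simpa using h4
    simpa using t1.add t2
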